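/- Let $(M,g)$ be a closed (compact, without boundary), connected smooth Riemannian manifold and let $\sigma\in\Omega^2(M)$ be a closed two-form. The Lorentz force $Y\colon TM\to TM$ is defined by $g_q(Y_qu,v)=\sigma_q(u,v)$ for all $q\in M$ and $u,v\in T_qM$. A smooth curve $\gamma\colon I\to M$ on an open interval $I\subseteq\mathbb{R}$ is called a magnetic geodesic of $(M,g,\sigma)$ if $\nabla_{\dot\gamma}\dot\gamma=Y_\gamma\dot\gamma$, where $\nabla$ is the Levi-Civita connection of $g$. An embedded submanifold $N\subseteq M$ is called totally magnetic if for every magnetic geodesic $\gamma\colon I\to M$ with $0\in I$, $\gamma(0)\in N$ and $\dot\gamma(0)\in T_{\gamma(0)}N$ there exists $\varepsilon>0$ such that $(-\varepsilon,\varepsilon)\subseteq I$ and $\gamma((-\varepsilon,\varepsilon))\subseteq N$. Proposition. Let $N_1,N_2\subseteq M$ be totally magnetic submanifolds of $(M,g,\sigma)$. Then each connected component $C$ of $N_1\cap N_2$ is a totally magnetic submanifold of $(M,g,\sigma)$, and its tangent space at every $p\in C$ is $T_pC=T_pN_1\cap T_pN_2$. -/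

import Mathlib

open Set Filter Bundle
open scoped Topology Manifold ContDiff

noncomputable section

namespace MagneticGeometry

/-- A smooth Riemannian metric on an `n`-dimensional smooth manifold (without boundary). -/
abbrev Metric (n : ℕ) (M : Type*) [TopologicalSpace M]
    [ChartedSpace (EuclideanSpace ℝ (Fin n)) M] [IsManifold (𝓡 n) ∞ M] :=
  ContMDiffRiemannianMetric (𝓡 n) ∞ (EuclideanSpace ℝ (Fin n))
    (fun x : M => TangentSpace (𝓡 n) x)

theorem update_pair_zero {V : Type*} (u v w : V) : Function.update ![u, v] 0 w = ![w, v] := by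
  funext i; fin_cases i <;> simp

theorem update_pair_one {V : Type*} (u v w : V) : Function.update ![u, v] 1 w = ![u, w] := by
  funext i; fin_cases i <;> simp

section Forms

variable {n : ℕ} {M : Type*} [TopologicalSpace M] [ChartedSpace (EuclideanSpace ℝ (Fin n)) M]

/-- The coordinate expression, in the preferred chart `φ` at `p`, of a field `σ` of alternating
`2`-forms: the pullback `(φ⁻¹)^* σ`, to be used on `φ.target`. -/
def formInChart (σ : ∀ x : M, TangentSpace (𝓡 n) x [⋀^Fin 2]→L[ℝ] ℝ) (p : M)
    (y : EuclideanSpace ℝ (Fin n)) : EuclideanSpace ℝ (Fin n) [⋀^Fin 2]→L[ℝ] ℝ :=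
  (σ ((extChartAt (𝓡 n) p).symm y)).compContinuousLinearMap
    (mfderiv 𝓘(ℝ, EuclideanSpace ℝ (Fin n)) (𝓡 n) (extChartAt (𝓡 n) p).symm y)

end Forms

/-- A magnetic field: a smooth closed differential `2`-form on `M`. Smoothness and `dσ = 0` are
expressed in the charts of `M`. -/
structure MagneticField (n : ℕ) (M : Type*) [TopologicalSpace M]
    [ChartedSpace (EuclideanSpace ℝ (Fin n)) M] where
  form : ∀ x : M, TangentSpace (𝓡 n) x [⋀^Fin 2]→L[ℝ] ℝ
  smooth : ∀ p : M, ContDiffOn ℝ ∞ (formInChart form p) (extChartAt (𝓡 n) p).target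
  closed : ∀ p : M, ∀ y ∈ (extChartAt (𝓡 n) p).target, extDeriv (formInChart form p) y = 0

variable {n : ℕ} {M : Type*} [TopologicalSpace M] [ChartedSpace (EuclideanSpace ℝ (Fin n)) M]
  [IsManifold (𝓡 n) ∞ M]

/-- The bilinear form `g_p` on `T_p M`. -/
def Metric.bilin (g : Metric n M) (p : M) : LinearMap.BilinForm ℝ (TangentSpace (𝓡 n) p) :=
  LinearMap.mk₂ ℝ (fun u v => g.inner p u v) (by simp) (by simp) (by simp) (by simp)

theorem Metric.bilin_nondegenerate (g : Metric n M) (p : M) : (g.bilin p).Nondegenerate := by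
  constructor
  · intro v hv
    by_contra h
    exact (g.pos p v h).ne' (hv v)
  · intro v hv
    by_contra h
    exact (g.pos p v h).ne' (hv v)

instance (p : M) : FiniteDimensional ℝ (TangentSpace (𝓡 n) p) :=
  inferInstanceAs (FiniteDimensional ℝ (EuclideanSpace ℝ (Fin n)))

/-- The musical isomorphism `T_p^* M → T_p M` of the metric `g`. -/
def sharp (g : Metric n M) (p : M) :
    Module.Dual ℝ (TangentSpace (𝓡 n) p) ≃ₗ[ℝ] TangentSpace (𝓡 n) p :=
  ((g.bilin p).toDual (g.bilin_nondegenerate p)).symm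

theorem inner_sharp (g : Metric n M) (p : M) (f : Module.Dual ℝ (TangentSpace (𝓡 n) p))
    (w : TangentSpace (𝓡 n) p) : g.inner p (sharp g p f) w = f w :=
  LinearMap.BilinForm.apply_toDual_symm_apply (hB := g.bilin_nondegenerate p) f w

/-- The Lorentz force `Y_p : T_p M → T_p M`, given by `g_p(Y_p u, v) = σ_p(u, v)`. -/
def lorentzForce (g : Metric n M) (σ : MagneticField n M) (p : M) :
    TangentSpace (𝓡 n) p →ₗ[ℝ] TangentSpace (𝓡 n) p :=
  (sharp g p).toLinearMap ∘ₗ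
    LinearMap.mk₂ ℝ (fun u v => σ.form p ![u, v])
      (fun u u' v => by
        have h := (σ.form p).map_update_add ![u, v] 0 u u'
        simp only [update_pair_zero] at h
        exact h)
      (fun c u v => by
        have h := (σ.form p).map_update_smul ![u, v] 0 c u
        simp only [update_pair_zero] at h
        exact h)
      (fun u v v' => by
        have h := (σ.form p).map_update_add ![u, v] 1 v v'
        simp only [update_pair_one] at h
        exact h)
      (fun c u v => by
        have h := (σ.form p).map_update_smul ![u, v] 1 c v
        simp only [update_pair_one] at h
        exact h)

theorem inner_lorentzForce (g : Metric n M) (σ : MagneticField n M) (p : M)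
    (u v : TangentSpace (𝓡 n) p) :
    g.inner p (lorentzForce g σ p u) v = σ.form p ![u, v] :=
  inner_sharp g p _ v

/-- The coordinate expression of the metric in the preferred chart `φ` at `p`: the pullback
`(φ⁻¹)^* g`, to be used on `φ.target`. -/
def metricInChart (g : Metric n M) (p : M) (y : EuclideanSpace ℝ (Fin n)) :
    EuclideanSpace ℝ (Fin n) →L[ℝ] EuclideanSpace ℝ (Fin n) →L[ℝ] ℝ :=
  let x : M := (extChartAt (𝓡 n) p).symm y
  let A : EuclideanSpace ℝ (Fin n) →L[ℝ] EuclideanSpace ℝ (Fin n) :=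
    mfderiv 𝓘(ℝ, EuclideanSpace ℝ (Fin n)) (𝓡 n) (extChartAt (𝓡 n) p).symm y
  let B : EuclideanSpace ℝ (Fin n) →L[ℝ] EuclideanSpace ℝ (Fin n) →L[ℝ] ℝ := g.inner x
  B.bilinearComp A A

set_option synthInstance.maxHeartbeats 200000 in
/-- The functional `w ↦ ½ (∂_u g(v, w) + ∂_v g(u, w) - ∂_w g(u, v))` at `p`, with the derivatives
taken in the preferred chart at `p` (Christoffel symbols of the first kind). -/
def koszul (g : Metric n M) (p : M) (u v : TangentSpace (𝓡 n) p) :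
    Module.Dual ℝ (TangentSpace (𝓡 n) p) :=
  let dG : EuclideanSpace ℝ (Fin n) →L[ℝ] EuclideanSpace ℝ (Fin n) →L[ℝ]
      EuclideanSpace ℝ (Fin n) →L[ℝ] ℝ := fderiv ℝ (metricInChart g p) (extChartAt (𝓡 n) p p)
  (((1 / 2 : ℝ) • (dG u v + dG v u - (dG.flip u).flip v) : EuclideanSpace ℝ (Fin n) →L[ℝ] ℝ) :
    EuclideanSpace ℝ (Fin n) →ₗ[ℝ] ℝ)

/-- The Christoffel term `Γ(u, v) = ∑ Γᵏᵢⱼ uⁱ vʲ ∂ₖ` at `p` of the Levi-Civita connection of `g`,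
in the preferred chart at `p` (through which `T_p M` is identified with `ℝⁿ` in Mathlib). -/
def christoffel (g : Metric n M) (p : M) (u v : TangentSpace (𝓡 n) p) : TangentSpace (𝓡 n) p :=
  sharp g p (koszul g p u v)

/-- The velocity `γ'(t) ∈ T_{γ(t)} M` of a curve. -/
def velocity (γ : ℝ → M) (t : ℝ) : TangentSpace (𝓡 n) (γ t) :=
  mfderiv 𝓘(ℝ, ℝ) (𝓡 n) γ t (1 : ℝ)

/-- The Levi-Civita covariant derivative `(∇_{γ'} X)(t)` of a vector field `X` along the curve `γ`:
in the preferred chart at `γ(t)` it is the derivative of the coordinate vector of `X` plus the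
Christoffel term `Γ(γ', X)`. -/
def covDerivAlong (g : Metric n M) (γ : ℝ → M) (X : ∀ t, TangentSpace (𝓡 n) (γ t)) (t : ℝ) :
    TangentSpace (𝓡 n) (γ t) :=
  let coord : ℝ → EuclideanSpace ℝ (Fin n) := fun s =>
    mfderiv (𝓡 n) 𝓘(ℝ, EuclideanSpace ℝ (Fin n)) (extChartAt (𝓡 n) (γ t)) (γ s) (X s)
  let coordDeriv : TangentSpace (𝓡 n) (γ t) := deriv coord t
  coordDeriv + christoffel g (γ t) (velocity γ t) (X t)

/-- `γ` is a magnetic geodesic of `(M, g, σ)` on the open set of times `J`: it is smooth there and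
`∇_{γ'} γ' = Y γ'`. -/
def IsMagneticGeodesicOn (g : Metric n M) (σ : MagneticField n M) (γ : ℝ → M) (J : Set ℝ) : Prop :=
  ContMDiffOn 𝓘(ℝ, ℝ) (𝓡 n) ∞ γ J ∧
    ∀ t ∈ J, covDerivAlong g γ (velocity γ) t = lorentzForce g σ (γ t) (velocity γ t)

/-- `N` is an embedded `k`-dimensional smooth submanifold of `M`: every point of `N` lies in a slice
chart, i.e. a smooth chart of `M` which carries `N` to a `k`-dimensional linear subspace. -/
def IsEmbeddedSubmanifold (k : ℕ) (N : Set M) : Prop :=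
  ∀ p ∈ N, ∃ φ ∈ IsManifold.maximalAtlas (𝓡 n) ∞ M, p ∈ φ.source ∧
    ∃ W : Submodule ℝ (EuclideanSpace ℝ (Fin n)), Module.finrank ℝ W = k ∧
      ∀ q ∈ φ.source, q ∈ N ↔ φ q ∈ W

/-- The tangent space `T_p N ⊆ T_p M` of an embedded submanifold `N` at `p ∈ N`: the set of
velocities at time `0` of the smooth curves in `N` through `p`. -/
def tangentSpaceOf (N : Set M) (p : M) : Set (TangentSpace (𝓡 n) p) :=
  {v | ∃ c : ℝ → M, c 0 = p ∧ ContMDiffAt 𝓘(ℝ, ℝ) (𝓡 n) ∞ c 0 ∧ (∀ᶠ t in 𝓝 (0 : ℝ), c t ∈ N) ∧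
    (mfderiv 𝓘(ℝ, ℝ) (𝓡 n) c 0 (1 : ℝ) : EuclideanSpace ℝ (Fin n)) = v}

/-- `N` is a totally magnetic submanifold of `(M, g, σ)`. -/
def IsTotallyMagnetic (g : Metric n M) (σ : MagneticField n M) (N : Set M) : Prop :=
  (∃ k : ℕ, IsEmbeddedSubmanifold (n := n) k N) ∧
    ∀ (J : Set ℝ) (γ : ℝ → M), IsOpen J → J.OrdConnected → (0 : ℝ) ∈ J →
      IsMagneticGeodesicOn g σ γ J → γ 0 ∈ N → velocity (n := n) γ 0 ∈ tangentSpaceOf N (γ 0) →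
      ∃ ε > 0, Ioo (-ε) ε ⊆ J ∧ ∀ t ∈ Ioo (-ε) ε, γ t ∈ N

end MagneticGeometry

end

/-! Two submanifolds can meet badly, so the point is to show that `N₁ ∩ N₂` is a submanifold near
each of its points `p`; the magnetic flow supplies this. Let `T` be the intersection of the two
tangent spaces at `p`, read in a chart. Two maps compare `N₁ ∩ N₂` with `T`.

From the set to `T`: a local diffeomorphism `f` with derivative the identity at `p` is built from
the two slice charts so that it sends `N₁ ∩ N₂` into `T`. This uses only linear algebra
(`exists_decomposition_of_comap_inf_comap`) and the inverse function theorem.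

From `T` to the set: a magnetic geodesic with small initial velocity `v ∈ T` is tangent to both
submanifolds, hence stays in both up to a fixed time `τ` (`IsSliceChart.chart_symm_mem`). Its
position `Z v` at time `τ` lies in `N₁ ∩ N₂`, and `Z` is close to `v ↦ p + τ v` in the Lipschitz
sense (`exists_second_order_flow`).

So `f ∘ Z` maps a ball of `T` into `T` and is a small perturbation of `τ • id`; it covers a
neighbourhood of `0` in `T` (`eventually_exists_eq_of_approximates`). As `f` is injective, every
point near `p` with `f`-image in `T` is some `Z v`, thus lies in `N₁ ∩ N₂`, and `f` is a slice chart
(`exists_isSliceChart_inter`). Connected components then inherit slice charts, and their dimension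
is constant because it is locally constant. -/

section SecondOrderODE

/-! ### Second-order ODEs: the flow from a rest point as a function of the initial velocity. -/

variable {E : Type*} [NormedAddCommGroup E] [NormedSpace ℝ E]

/-- Local solutions of an autonomous ODE which stay in the ball where the vector field is
controlled. -/
theorem exists_solution_mem_closedBall [CompleteSpace E] {f : E → E} {x₀ x : E} {a K L : NNReal}
    {T : ℝ} (hT : 0 ≤ T) (hf : LipschitzOnWith K f (Metric.closedBall x₀ a))
    (hL : ∀ x ∈ Metric.closedBall x₀ (a : ℝ), ‖f x‖ ≤ L) (hLT : L * T ≤ a / 2)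
    (hx : x ∈ Metric.closedBall x₀ ((a : ℝ) / 2)) :
    ∃ α : ℝ → E, α 0 = x ∧ ∀ t ∈ Icc (-T) T,
      HasDerivWithinAt α (f (α t)) (Icc (-T) T) t ∧ α t ∈ Metric.closedBall x₀ (a : ℝ) := by
  have h0 : (0 : ℝ) ∈ Icc (-T) T := ⟨by linarith, hT⟩
  let t₀ : Icc (-T) T := ⟨0, h0⟩
  have hp : IsPicardLindelof (fun _ : ℝ => f) t₀ x₀ a (a / 2) L K := by
    refine IsPicardLindelof.of_time_independent hL hf ?_
    have : max (T - 0) (0 - -T) = T := by simp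
    change L * max (T - 0) (0 - -T) ≤ (a : ℝ) - ((a / 2 : NNReal) : ℝ)
    rw [this]
    push_cast
    linarith
  have hx' : x ∈ Metric.closedBall x₀ ((a / 2 : NNReal) : ℝ) := by
    push_cast
    exact hx
  -- Working with the Picard fixed point itself yields, besides the equation, that the curve never
  -- leaves the ball.
  obtain ⟨α, hα⟩ := ODE.FunSpace.exists_isFixedPt_next hp hx'
  refine ⟨α.compProj, ?_, fun t ht => ⟨?_, α.compProj_mem_closedBall hp.mul_max_le⟩⟩
  · change α.compProj t₀ = x
    rw [ODE.FunSpace.compProj_val, ← hα, ODE.FunSpace.next_apply₀]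
  · apply ODE.hasDerivWithinAt_picard_Icc h0 hp.continuousOn_uncurry
      α.continuous_compProj.continuousOn (fun _ _ => α.compProj_mem_closedBall hp.mul_max_le)
      x ht |>.congr_of_mem _ ht
    intro t' ht'
    nth_rw 1 [← hα]
    rw [ODE.FunSpace.compProj_of_mem ht', ODE.FunSpace.next_apply]

/-- Two solutions of `z'' = F (z, z')` issued from the same point stay, up to a small relative
error, at the distance given by their initial velocities. -/
theorem norm_sub_sub_smul_le_of_second_order_ODE {F : E × E → E} {s : Set (E × E)} {K : NNReal}
    {z₁ u₁ z₂ u₂ : ℝ → E} {y v₁ v₂ : E} {τ : ℝ} (hτ : 0 ≤ τ) (hKτ : K * τ ≤ 1 / 2)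
    (hF : LipschitzOnWith K (fun x : E × E => (x.2, F x)) s)
    (h₁ : ∀ t ∈ Icc 0 τ, HasDerivAt z₁ (u₁ t) t ∧ HasDerivAt u₁ (F (z₁ t, u₁ t)) t ∧
      (z₁ t, u₁ t) ∈ s)
    (h₂ : ∀ t ∈ Icc 0 τ, HasDerivAt z₂ (u₂ t) t ∧ HasDerivAt u₂ (F (z₂ t, u₂ t)) t ∧
      (z₂ t, u₂ t) ∈ s)
    (hz₁ : z₁ 0 = y) (hz₂ : z₂ 0 = y) (hu₁ : u₁ 0 = v₁) (hu₂ : u₂ 0 = v₂) :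
    ‖z₁ τ - z₂ τ - τ • (v₁ - v₂)‖ ≤ 2 * K * τ * τ * ‖v₁ - v₂‖ := by
  have hd₁ : ∀ t ∈ Icc 0 τ, HasDerivAt (fun t => (z₁ t, u₁ t)) (u₁ t, F (z₁ t, u₁ t)) t :=
    fun t ht => (h₁ t ht).1.prodMk (h₁ t ht).2.1
  have hd₂ : ∀ t ∈ Icc 0 τ, HasDerivAt (fun t => (z₂ t, u₂ t)) (u₂ t, F (z₂ t, u₂ t)) t :=
    fun t ht => (h₂ t ht).1.prodMk (h₂ t ht).2.1
  -- Grönwall's inequality; the factor `2` bounds `exp (K t) ≤ exp (1 / 2)`.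
  have hg : ∀ t ∈ Icc 0 τ, dist (z₁ t, u₁ t) (z₂ t, u₂ t) ≤ 2 * ‖v₁ - v₂‖ := by
    intro t ht
    have := dist_le_of_trajectories_ODE_of_mem (v := fun _ x => (x.2, F x)) (s := fun _ => s)
      (K := K) (a := 0) (b := τ) (δ := ‖v₁ - v₂‖) (fun _ _ => hF)
      (fun t ht => (hd₁ t ht).continuousAt.continuousWithinAt)
      (fun t ht => (hd₁ t (Ico_subset_Icc_self ht)).hasDerivWithinAt)
      (fun t ht => (h₁ t (Ico_subset_Icc_self ht)).2.2)
      (fun t ht => (hd₂ t ht).continuousAt.continuousWithinAt)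
      (fun t ht => (hd₂ t (Ico_subset_Icc_self ht)).hasDerivWithinAt)
      (fun t ht => (h₂ t (Ico_subset_Icc_self ht)).2.2)
      (by rw [hz₁, hz₂, hu₁, hu₂, dist_eq_norm]; simp) t ht
    refine this.trans ?_
    rw [mul_comm]
    gcongr
    have h1 : (K : ℝ) * (t - 0) ≤ 1 / 2 := by
      refine le_trans ?_ hKτ
      gcongr
      linarith [ht.2]
    calc Real.exp (K * (t - 0)) ≤ Real.exp (1 / 2) := Real.exp_le_exp.2 h1
      _ ≤ 2 := by
        have h2 : Real.exp (1 / 2) ^ 2 = Real.exp 1 := by rw [← Real.exp_nat_mul]; norm_num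
        nlinarith [Real.exp_one_lt_d9, Real.exp_pos (1 / 2)]
  have hu : ∀ t ∈ Icc 0 τ, ‖u₁ t - u₂ t - (v₁ - v₂)‖ ≤ 2 * K * τ * ‖v₁ - v₂‖ := by
    intro t ht
    have := norm_image_sub_le_of_norm_deriv_le_segment' (f := fun t => u₁ t - u₂ t)
      (f' := fun t => F (z₁ t, u₁ t) - F (z₂ t, u₂ t)) (a := 0) (b := τ)
      (C := 2 * K * ‖v₁ - v₂‖)
      (fun t ht => ((h₁ t ht).2.1.sub (h₂ t ht).2.1).hasDerivWithinAt)
      (fun t ht => by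
        have ht' := Ico_subset_Icc_self ht
        have h3 := hF.dist_le_mul _ (h₁ t ht').2.2 _ (h₂ t ht').2.2
        rw [← dist_eq_norm]
        refine (le_max_right _ _).trans (h3.trans ?_)
        calc (K : ℝ) * _ ≤ K * (2 * ‖v₁ - v₂‖) := by gcongr; exact hg t ht'
          _ = _ := by ring) t ht
    simp only [hu₁, hu₂] at this
    refine this.trans ?_
    calc 2 * K * ‖v₁ - v₂‖ * (t - 0) ≤ 2 * K * ‖v₁ - v₂‖ * τ := by gcongr; linarith [ht.2]
      _ = _ := by ring
  -- The velocity estimate `hu` is integrated once more, which gives the second factor `τ`.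
  have := norm_image_sub_le_of_norm_deriv_le_segment'
    (f := fun t => z₁ t - z₂ t - t • (v₁ - v₂))
    (f' := fun t => u₁ t - u₂ t - (1 : ℝ) • (v₁ - v₂)) (a := 0) (b := τ)
    (C := 2 * K * τ * ‖v₁ - v₂‖)
    (fun t ht => (((h₁ t ht).1.sub (h₂ t ht).1).sub
      ((hasDerivAt_id t).smul_const (v₁ - v₂))).hasDerivWithinAt)
    (fun t ht => by rw [one_smul]; exact hu t (Ico_subset_Icc_self ht)) τ ⟨hτ, le_rfl⟩
  simp only [hz₁, hz₂, sub_self, zero_smul, sub_zero] at this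
  refine this.trans (le_of_eq (by ring))

/-- The solutions of `z'' = F (z, z')` issued from a point `y` at which `F (y, 0) = 0`, as functions
of the initial velocity: after a short time `τ` they are close to `y + τ v`, in the `C¹` sense. -/
theorem exists_second_order_flow [CompleteSpace E] {F : E × E → E} {y : E} (hF : ContDiffAt ℝ 1 F (y, 0))
    (h0 : F (y, 0) = 0) {V : Set (E × E)} (hV : V ∈ 𝓝 (y, (0 : E))) {δ : ℝ} (hδ : 0 < δ) :
    ∃ τ > 0, ∃ r > 0, ∃ z u : E → ℝ → E,
      (∀ v ∈ Metric.ball (0 : E) r, z v 0 = y ∧ u v 0 = v ∧ ∀ t ∈ Ioo (-(2 * τ)) (2 * τ),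
        HasDerivAt (z v) (u v t) t ∧ HasDerivAt (u v) (F (z v t, u v t)) t ∧ (z v t, u v t) ∈ V) ∧
      (∀ v ∈ Metric.ball (0 : E) r, ∀ w ∈ Metric.ball (0 : E) r,
        ‖z v τ - z w τ - τ • (v - w)‖ ≤ δ * τ * ‖v - w‖) ∧
      z 0 τ = y := by
  set H : E × E → E × E := fun x => (x.2, F x) with hH
  have hHc : ContDiffAt ℝ 1 H (y, 0) := contDiffAt_snd.prodMk hF
  have hH0 : H (y, 0) = 0 := by simp [hH, h0]
  obtain ⟨K, s, hs, hl⟩ := hHc.exists_lipschitzOnWith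
  obtain ⟨b, hb, hbs⟩ := Metric.nhds_basis_closedBall.mem_iff.1 (inter_mem hs hV)
  lift b to NNReal using hb.le
  have hb' : (0 : ℝ) < b := hb
  have hmem0 : (y, (0 : E)) ∈ Metric.closedBall (y, (0 : E)) (b : ℝ) := Metric.mem_closedBall_self b.2
  have hlb : LipschitzOnWith K H (Metric.closedBall (y, (0 : E)) b) :=
    hl.mono (hbs.trans inter_subset_left)
  have hbound : ∀ x ∈ Metric.closedBall (y, (0 : E)) (b : ℝ), ‖H x‖ ≤ K * b := by
    intro x hx
    have := hlb.dist_le_mul x hx _ hmem0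
    rw [hH0, dist_zero_right] at this
    exact this.trans (by gcongr; exact hx)
  -- This `T` gives `K T ≤ 1 / 2`, used twice: at speed at most `K b` a solution starting within `b
  -- / 2` of the centre stays in the ball of radius `b`, and the Grönwall factor is at most `2`.
  set T : ℝ := 1 / (2 * (K + 1)) with hTdef
  have hT : 0 < T := by positivity
  have hKT : K * T ≤ 1 / 2 := by
    rw [hTdef, mul_one_div, div_le_div_iff₀ (by positivity) (by norm_num)]
    linarith [K.2]
  have hex : ∀ v ∈ Metric.ball (0 : E) (b / 2), ∃ α : ℝ → E × E, α 0 = (y, v) ∧ ∀ t ∈ Icc (-T) T,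
      HasDerivWithinAt α (H (α t)) (Icc (-T) T) t ∧ α t ∈ Metric.closedBall (y, (0 : E)) b := by
    intro v hv
    refine exists_solution_mem_closedBall (L := K * b) hT.le hlb hbound ?_ ?_
    · calc (K * b : NNReal) * T = (K * T) * b := by push_cast; ring
        _ ≤ 1 / 2 * b := by gcongr
        _ = b / 2 := by ring
    · simp only [Metric.mem_closedBall, Prod.dist_eq, dist_self]
      exact max_le (by positivity) (Metric.mem_ball.1 hv).le
  classical
  choose! α hα0 hα using hex
  -- The first bound puts `(-2τ, 2τ)` inside `[-T, T]`, so that `τ` is an interior time; the second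
  -- turns the error `2 K τ · τ ‖v - w‖` into at most `δ τ ‖v - w‖`.
  set τ : ℝ := min (T / 2) (δ / (2 * K + 1)) with hτdef
  have hτ : 0 < τ := by positivity
  have hτT : 2 * τ ≤ T := by
    have : τ ≤ T / 2 := min_le_left _ _
    linarith
  have hKδ : 2 * K * τ ≤ δ := by
    have h1 : τ ≤ δ / (2 * K + 1) := min_le_right _ _
    rw [le_div_iff₀ (by positivity)] at h1
    linarith
  have hKτ : K * τ ≤ 1 / 2 := le_trans (by gcongr; linarith) hKT
  have hprop : ∀ v ∈ Metric.ball (0 : E) (b / 2), ∀ t ∈ Ioo (-(2 * τ)) (2 * τ),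
      HasDerivAt (fun t => (α v t).1) (α v t).2 t ∧
      HasDerivAt (fun t => (α v t).2) (F ((α v t).1, (α v t).2)) t ∧
      ((α v t).1, (α v t).2) ∈ Metric.closedBall (y, (0 : E)) (b : ℝ) := by
    intro v hv t ht
    have htT : t ∈ Ioo (-T) T := ⟨by linarith [ht.1], by linarith [ht.2]⟩
    obtain ⟨h1, h2⟩ := hα v hv t (Ioo_subset_Icc_self htT)
    have h3 : HasDerivAt (α v) (H (α v t)) t := h1.hasDerivAt (Icc_mem_nhds htT.1 htT.2)
    exact ⟨h3.fst, h3.snd, h2⟩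
  have hsub : Icc 0 τ ⊆ Ioo (-(2 * τ)) (2 * τ) := fun t ht => ⟨by linarith [ht.1], by linarith [ht.2]⟩
  have hr : (0 : E) ∈ Metric.ball (0 : E) (b / 2) := Metric.mem_ball_self (by positivity)
  refine ⟨τ, hτ, b / 2, by positivity, fun v t => (α v t).1, fun v t => (α v t).2, ?_, ?_, ?_⟩
  · intro v hv
    refine ⟨by simp [hα0 v hv], by simp [hα0 v hv], fun t ht => ?_⟩
    obtain ⟨h1, h2, h3⟩ := hprop v hv t ht
    exact ⟨h1, h2, (hbs h3).2⟩
  · intro v hv w hw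
    have := norm_sub_sub_smul_le_of_second_order_ODE (F := F) hτ.le hKτ hlb
      (fun t ht => hprop v hv t (hsub ht)) (fun t ht => hprop w hw t (hsub ht))
      (y := y) (v₁ := v) (v₂ := w) (by simp [hα0 v hv]) (by simp [hα0 w hw])
      (by simp [hα0 v hv]) (by simp [hα0 w hw])
    refine this.trans ?_
    gcongr
  -- Comparison with the constant solution at the equilibrium `(y, 0)`: equal initial data force
  -- equality.
  · have := norm_sub_sub_smul_le_of_second_order_ODE (F := F) hτ.le hKτ hlb
      (fun t ht => hprop 0 hr t (hsub ht)) (z₂ := fun _ => y) (u₂ := fun _ => 0)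
      (fun t ht => ⟨hasDerivAt_const t y, by rw [h0]; exact hasDerivAt_const t 0, hmem0⟩)
      (y := y) (v₁ := 0) (v₂ := 0) (by simp [hα0 0 hr]) rfl (by simp [hα0 0 hr]) rfl
    simpa [sub_eq_zero] using this

/-- Solutions of `z'' = F (z, z')` with smooth `F` are smooth. -/
theorem contDiffOn_of_second_order_ODE [CompleteSpace E] {F : E × E → E} {V : Set (E × E)} (hF : ContDiffOn ℝ ∞ F V)
    {z u : ℝ → E} {J : Set ℝ} (hJ : IsOpen J)
    (h : ∀ t ∈ J, HasDerivAt z (u t) t ∧ HasDerivAt u (F (z t, u t)) t ∧ (z t, u t) ∈ V) :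
    ContDiffOn ℝ ∞ z J := by
  intro t ht
  obtain ⟨ε, hε, hεJ⟩ := Metric.nhds_basis_closedBall.mem_iff.1 (hJ.mem_nhds ht)
  rw [Real.closedBall_eq_Icc] at hεJ
  have h1 : ContDiffOn ℝ ∞ (fun t => (z t, u t)) (Icc (t - ε) (t + ε)) := by
    refine ODE.contDiffOn_enat_Icc_of_hasDerivWithinAt (n := ⊤) (u := V)
      (f := fun _ x => (x.2, F x)) ?_ ?_ fun t ht => (h t (hεJ ht)).2.2
    · exact (contDiff_snd.snd.contDiffOn).prodMk
        (hF.comp contDiff_snd.contDiffOn fun x hx => hx.2)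
    · intro t ht
      obtain ⟨h1, h2, -⟩ := h t (hεJ ht)
      exact (h1.prodMk h2).hasDerivWithinAt
  have h2 := h1.contDiffAt (Icc_mem_nhds (by linarith : t - ε < t) (by linarith))
  exact h2.fst.contDiffWithinAt

end SecondOrderODE

/-! ### Christoffel symbols of the first kind under a change of coordinates. -/

noncomputable section

section PullbackOfBilinearForms

variable {E E' : Type*} [NormedAddCommGroup E] [NormedSpace ℝ E] [NormedAddCommGroup E']
  [NormedSpace ℝ E']

set_option maxSynthPendingDepth 3 in
/-- The derivative of the pullback `ψ^* G₂` of a field of bilinear forms. -/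
theorem fderiv_pullback_bilinear {G₁ : E → E →L[ℝ] E →L[ℝ] ℝ} {G₂ : E' → E' →L[ℝ] E' →L[ℝ] ℝ}
    {ψ : E → E'} {y : E} (hψ : ContDiffAt ℝ 2 ψ y) (hG₁ : DifferentiableAt ℝ G₁ y)
    (hG₂ : DifferentiableAt ℝ G₂ (ψ y))
    (h : ∀ᶠ x in 𝓝 y, ∀ a b, G₁ x a b = G₂ (ψ x) (fderiv ℝ ψ x a) (fderiv ℝ ψ x b)) (c a b : E) :
    fderiv ℝ G₁ y c a b =
      fderiv ℝ G₂ (ψ y) (fderiv ℝ ψ y c) (fderiv ℝ ψ y a) (fderiv ℝ ψ y b) +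
      G₂ (ψ y) (fderiv ℝ (fderiv ℝ ψ) y c a) (fderiv ℝ ψ y b) +
      G₂ (ψ y) (fderiv ℝ ψ y a) (fderiv ℝ (fderiv ℝ ψ) y c b) := by
  have hψ1 : HasFDerivAt ψ (fderiv ℝ ψ y) y := (hψ.differentiableAt (by norm_num)).hasFDerivAt
  have hψ2 : HasFDerivAt (fderiv ℝ ψ) (fderiv ℝ (fderiv ℝ ψ) y) y :=
    ((hψ.fderiv_right (m := 1) (by norm_num)).differentiableAt (by norm_num)).hasFDerivAt
  have h1 : HasFDerivAt (fun x => G₁ x a b) _ y :=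
    (hG₁.hasFDerivAt.clm_apply (hasFDerivAt_const a y)).clm_apply (hasFDerivAt_const b y)
  have h2 : HasFDerivAt (fun x => G₂ (ψ x) (fderiv ℝ ψ x a) (fderiv ℝ ψ x b)) _ y :=
    ((hG₂.hasFDerivAt.comp y hψ1).clm_apply (hψ2.clm_apply (hasFDerivAt_const a y))).clm_apply
      (hψ2.clm_apply (hasFDerivAt_const b y))
  have h3 := h1.unique (h2.congr_of_eventuallyEq (h.mono fun x hx => hx a b))
  have h4 := DFunLike.congr_fun h3 c
  simpa [add_comm, add_left_comm, add_assoc] using h4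

/-- The transformation rule of the Christoffel symbols of the first kind, on the diagonal. -/
theorem christoffel_first_kind_pullback {G₁ : E → E →L[ℝ] E →L[ℝ] ℝ}
    {G₂ : E' → E' →L[ℝ] E' →L[ℝ] ℝ}
    {ψ : E → E'} {y : E} (hψ : ContDiffAt ℝ 2 ψ y) (hG₁ : DifferentiableAt ℝ G₁ y)
    (hG₂ : DifferentiableAt ℝ G₂ (ψ y))
    (h : ∀ᶠ x in 𝓝 y, ∀ a b, G₁ x a b = G₂ (ψ x) (fderiv ℝ ψ x a) (fderiv ℝ ψ x b))
    (hsymm : ∀ a b, G₂ (ψ y) a b = G₂ (ψ y) b a) (u w : E) :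
    fderiv ℝ G₁ y u u w - 1 / 2 * fderiv ℝ G₁ y w u u =
      fderiv ℝ G₂ (ψ y) (fderiv ℝ ψ y u) (fderiv ℝ ψ y u) (fderiv ℝ ψ y w) -
      1 / 2 * fderiv ℝ G₂ (ψ y) (fderiv ℝ ψ y w) (fderiv ℝ ψ y u) (fderiv ℝ ψ y u) +
      G₂ (ψ y) (fderiv ℝ (fderiv ℝ ψ) y u u) (fderiv ℝ ψ y w) := by
  -- By symmetry of the second derivative the terms in `ψ'' (u, w)` cancel, and only the one in `ψ''
  -- (u, u)` survives.
  have hs : fderiv ℝ (fderiv ℝ ψ) y u w = fderiv ℝ (fderiv ℝ ψ) y w u :=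
    (hψ.isSymmSndFDerivAt (by simp)) u w
  rw [fderiv_pullback_bilinear hψ hG₁ hG₂ h, fderiv_pullback_bilinear hψ hG₁ hG₂ h, hs,
    hsymm (fderiv ℝ ψ y u) (fderiv ℝ (fderiv ℝ ψ) y w u)]
  ring

end PullbackOfBilinearForms

theorem contMDiff_constant_vectorField {E : Type*} [NormedAddCommGroup E] [NormedSpace ℝ E]
    (a : E) : ContMDiff 𝓘(ℝ, E) 𝓘(ℝ, E).tangent ∞
      (fun y => TotalSpace.mk' E y a : E → TangentBundle 𝓘(ℝ, E) E) := by
  intro y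
  exact (contMDiffAt_vectorSpace_iff_contDiffAt (V := fun _ => a)).2 contDiffAt_const

/-! ### Transition maps and smoothness of the metric coefficients. -/

namespace MagneticGeometry

variable {n : ℕ} {M : Type*} [TopologicalSpace M] [ChartedSpace (EuclideanSpace ℝ (Fin n)) M]

/-- The derivative of the inverse of the preferred chart at `p`. -/
def chartSymmDeriv (p : M) (y : EuclideanSpace ℝ (Fin n)) :
    EuclideanSpace ℝ (Fin n) →L[ℝ] EuclideanSpace ℝ (Fin n) :=
  mfderiv 𝓘(ℝ, EuclideanSpace ℝ (Fin n)) (𝓡 n) (extChartAt (𝓡 n) p).symm y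

/-- The transition map from the preferred chart at `p` to the one at `q`. -/
def transition (p q : M) (y : EuclideanSpace ℝ (Fin n)) : EuclideanSpace ℝ (Fin n) :=
  extChartAt (𝓡 n) q ((extChartAt (𝓡 n) p).symm y)

theorem isOpen_target (p : M) : IsOpen (extChartAt (𝓡 n) p).target :=
  isOpen_extChartAt_target p

theorem eventually_mem_source (p q : M) {y : EuclideanSpace ℝ (Fin n)}
    (hy : y ∈ (extChartAt (𝓡 n) p).target)
    (hq : (extChartAt (𝓡 n) p).symm y ∈ (extChartAt (𝓡 n) q).source) :
    ∀ᶠ x in 𝓝 y, x ∈ (extChartAt (𝓡 n) p).target ∧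
      (extChartAt (𝓡 n) p).symm x ∈ (extChartAt (𝓡 n) q).source := by
  have hc : ContinuousAt (extChartAt (𝓡 n) p).symm y := continuousAt_extChartAt_symm'' hy
  exact (Filter.eventually_mem_set.2 ((isOpen_target p).mem_nhds hy)).and
    (hc.eventually ((isOpen_extChartAt_source q).mem_nhds hq))

variable [IsManifold (𝓡 n) ∞ M]

theorem mdifferentiableAt_chart_symm (p : M) {y : EuclideanSpace ℝ (Fin n)}
    (hy : y ∈ (extChartAt (𝓡 n) p).target) :
    MDifferentiableAt 𝓘(ℝ, EuclideanSpace ℝ (Fin n)) (𝓡 n) (extChartAt (𝓡 n) p).symm y := by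
  have := mdifferentiableWithinAt_extChartAt_symm (I := 𝓡 n) hy
  simpa [mdifferentiableWithinAt_univ] using this

/-- The tangent space at `x` is identified with `ℝⁿ` through the preferred chart at `x`, so the
manifold derivative at `y` is that of the transition into the chart at the image point. That chart
changes with `y`. -/
theorem chartSymmDeriv_eq_fderiv_transition (p : M) {y : EuclideanSpace ℝ (Fin n)}
    (hy : y ∈ (extChartAt (𝓡 n) p).target) :
    chartSymmDeriv p y = fderiv ℝ (transition p ((extChartAt (𝓡 n) p).symm y)) y := by
  have h := mdifferentiableAt_chart_symm p hy
  unfold chartSymmDeriv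
  rw [h.mfderiv]
  simp only [writtenInExtChartAt, extChartAt_model_space_eq_id, PartialEquiv.refl_symm,
    PartialEquiv.refl_coe, modelWithCornersSelf_coe, range_id, fderivWithin_univ, id_eq]
  rfl

theorem isInvertible_chartSymmDeriv (p : M) {y : EuclideanSpace ℝ (Fin n)}
    (hy : y ∈ (extChartAt (𝓡 n) p).target) : (chartSymmDeriv p y).IsInvertible := by
  have := isInvertible_mfderivWithin_extChartAt_symm (I := 𝓡 n) hy
  rw [ModelWithCorners.range_eq_univ, mfderivWithin_univ] at this
  exact this

theorem contMDiffOn_chart_symm (p : M) :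
    ContMDiffOn 𝓘(ℝ, EuclideanSpace ℝ (Fin n)) (𝓡 n) ∞ (extChartAt (𝓡 n) p).symm
      (extChartAt (𝓡 n) p).target :=
  contMDiffOn_extChartAt_symm p

theorem contDiffAt_transition (p q : M) {y : EuclideanSpace ℝ (Fin n)}
    (hy : y ∈ (extChartAt (𝓡 n) p).target)
    (hq : (extChartAt (𝓡 n) p).symm y ∈ (extChartAt (𝓡 n) q).source) :
    ContDiffAt ℝ ∞ (transition p q) y := by
  rw [← contMDiffAt_iff_contDiffAt]
  refine ContMDiffAt.comp y (contMDiffAt_extChartAt' ?_)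
    ((contMDiffOn_chart_symm p).contMDiffAt ((isOpen_target p).mem_nhds hy))
  rwa [extChartAt_source] at hq

theorem chartSymmDeriv_comp_transition (p q : M) {y : EuclideanSpace ℝ (Fin n)}
    (hy : y ∈ (extChartAt (𝓡 n) p).target)
    (hq : (extChartAt (𝓡 n) p).symm y ∈ (extChartAt (𝓡 n) q).source) :
    chartSymmDeriv p y = (chartSymmDeriv q (transition p q y)).comp
      (fderiv ℝ (transition p q) y) := by
  have h1 : (extChartAt (𝓡 n) p).symm =ᶠ[𝓝 y]
      (extChartAt (𝓡 n) q).symm ∘ transition p q := by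
    filter_upwards [eventually_mem_source p q hy hq] with x hx
    exact ((extChartAt (𝓡 n) q).left_inv hx.2).symm
  have h2 : transition p q y ∈ (extChartAt (𝓡 n) q).target := (extChartAt (𝓡 n) q).map_source hq
  have h3 : MDifferentiableAt 𝓘(ℝ, EuclideanSpace ℝ (Fin n)) 𝓘(ℝ, EuclideanSpace ℝ (Fin n))
      (transition p q) y :=
    ((contDiffAt_transition p q hy hq).differentiableAt (by simp)).mdifferentiableAt
  have h4 := mfderiv_comp y (mdifferentiableAt_chart_symm q h2) h3
  rw [← h1.mfderiv_eq, mfderiv_eq_fderiv] at h4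
  exact h4

/-- The metric, with every tangent space identified with `ℝⁿ`. -/
def metricForm (g : Metric n M) (x : M) :
    EuclideanSpace ℝ (Fin n) →L[ℝ] EuclideanSpace ℝ (Fin n) →L[ℝ] ℝ :=
  g.inner x

theorem metricInChart_apply (g : Metric n M) (p : M) (y a b : EuclideanSpace ℝ (Fin n)) :
    metricInChart g p y a b = metricForm g ((extChartAt (𝓡 n) p).symm y) (chartSymmDeriv p y a)
      (chartSymmDeriv p y b) := rfl

theorem metricInChart_eq_pullback (g : Metric n M) (p q : M) {y : EuclideanSpace ℝ (Fin n)}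
    (hy : y ∈ (extChartAt (𝓡 n) p).target)
    (hq : (extChartAt (𝓡 n) p).symm y ∈ (extChartAt (𝓡 n) q).source)
    (a b : EuclideanSpace ℝ (Fin n)) :
    metricInChart g p y a b = metricInChart g q (transition p q y)
      (fderiv ℝ (transition p q) y a) (fderiv ℝ (transition p q) y b) := by
  rw [metricInChart_apply, metricInChart_apply, chartSymmDeriv_comp_transition p q hy hq]
  have : (extChartAt (𝓡 n) q).symm (transition p q y) = (extChartAt (𝓡 n) p).symm y :=
    (extChartAt (𝓡 n) q).left_inv hq
  rw [this]
  rfl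

/-- As a matrix, `chartSymmDeriv p y` may jump with `y`, since the preferred chart at the image
point does. Smoothness is therefore obtained from sections of the tangent bundle: the metric paired
with two smooth coordinate fields is a smooth function. -/
theorem contDiffOn_metricInChart (g : Metric n M) (p : M) :
    ContDiffOn ℝ ∞ (metricInChart g p) (extChartAt (𝓡 n) p).target := by
  have hsec : ∀ a : EuclideanSpace ℝ (Fin n),
      ContMDiffOn 𝓘(ℝ, EuclideanSpace ℝ (Fin n)) (𝓡 n).tangent ∞
        (fun y => (TotalSpace.mk' (EuclideanSpace ℝ (Fin n)) ((extChartAt (𝓡 n) p).symm y)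
          (chartSymmDeriv p y a) : TangentBundle (𝓡 n) M)) (extChartAt (𝓡 n) p).target := by
    intro a
    have h1 := (contMDiffOn_chart_symm (n := n) p).contMDiffOn_tangentMapWithin (m := ∞) (by simp)
      (isOpen_target p).uniqueMDiffOn
    have h2 := contMDiff_constant_vectorField a
    refine (h1.comp h2.contMDiffOn fun y hy => hy).congr fun y hy => ?_
    simp only [Function.comp, tangentMapWithin, chartSymmDeriv]
    rw [mfderivWithin_of_isOpen (isOpen_target p) hy]
    rfl
  refine contDiffOn_clm_apply.2 fun a => contDiffOn_clm_apply.2 fun b => ?_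
  rw [← contMDiffOn_iff_contDiffOn]
  intro y hy
  have h3 : ContMDiffWithinAt 𝓘(ℝ, EuclideanSpace ℝ (Fin n)) ((𝓡 n).prod 𝓘(ℝ)) ∞
      (fun y => TotalSpace.mk' ℝ (E := Bundle.Trivial M ℝ) ((extChartAt (𝓡 n) p).symm y)
        (g.inner ((extChartAt (𝓡 n) p).symm y) (chartSymmDeriv p y a) (chartSymmDeriv p y b)))
      (extChartAt (𝓡 n) p).target y := by
    apply ContMDiffWithinAt.clm_bundle_apply₂ (F₁ := EuclideanSpace ℝ (Fin n))
      (F₂ := EuclideanSpace ℝ (Fin n))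
    · exact ContMDiffAt.comp_contMDiffWithinAt y g.contMDiff.contMDiffAt
        (contMDiffOn_chart_symm p y hy)
    · exact hsec a y hy
    · exact hsec b y hy
  simp only [contMDiffWithinAt_totalSpace] at h3
  exact h3.2

end MagneticGeometry
end

/-! ### The magnetic geodesic equation in one fixed chart. -/

noncomputable section

namespace MagneticGeometry

variable {n : ℕ} {M : Type*} [TopologicalSpace M] [ChartedSpace (EuclideanSpace ℝ (Fin n)) M]

theorem transition_self_eventuallyEq (p : M) {y : EuclideanSpace ℝ (Fin n)}
    (hy : y ∈ (extChartAt (𝓡 n) p).target) : transition p p =ᶠ[𝓝 y] id := by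
  filter_upwards [(isOpen_target p).mem_nhds hy] with x hx
  exact (extChartAt (𝓡 n) p).right_inv hx

theorem formInChart_apply (σ : MagneticField n M) (p : M) (y u w : EuclideanSpace ℝ (Fin n)) :
    formInChart σ.form p y ![u, w] = σ.form ((extChartAt (𝓡 n) p).symm y)
      ![chartSymmDeriv p y u, chartSymmDeriv p y w] := by
  have h : (chartSymmDeriv p y ∘ ![u, w] : Fin 2 → EuclideanSpace ℝ (Fin n)) =
      ![chartSymmDeriv p y u, chartSymmDeriv p y w] := by
    funext i
    fin_cases i <;> rfl
  exact congrArg (σ.form ((extChartAt (𝓡 n) p).symm y)) h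

variable [IsManifold (𝓡 n) ∞ M]

theorem chartSymmDeriv_self (q : M) :
    chartSymmDeriv q (extChartAt (𝓡 n) q q) = ContinuousLinearMap.id ℝ _ := by
  have hy : extChartAt (𝓡 n) q q ∈ (extChartAt (𝓡 n) q).target := mem_extChartAt_target q
  rw [chartSymmDeriv_eq_fderiv_transition q hy, extChartAt_to_inv,
    (transition_self_eventuallyEq q hy).fderiv_eq, fderiv_id]

theorem metricInChart_self (g : Metric n M) (q : M) :
    metricInChart g q (extChartAt (𝓡 n) q q) = metricForm g q := by
  ext1 a
  ext1 b
  rw [metricInChart_apply, chartSymmDeriv_self, extChartAt_to_inv]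
  rfl

theorem differentiableAt_metricInChart (g : Metric n M) (p : M) {y : EuclideanSpace ℝ (Fin n)}
    (hy : y ∈ (extChartAt (𝓡 n) p).target) : DifferentiableAt ℝ (metricInChart g p) y :=
  ((contDiffOn_metricInChart g p).contDiffAt ((isOpen_target p).mem_nhds hy)).differentiableAt
    (by simp)

/-- The Christoffel symbols of the first kind on the diagonal, in the preferred chart at `p`. -/
def christoffelInChart (g : Metric n M) (p : M) (y u w : EuclideanSpace ℝ (Fin n)) : ℝ :=
  fderiv ℝ (metricInChart g p) y u u w - 1 / 2 * fderiv ℝ (metricInChart g p) y w u u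

theorem koszul_self_apply (g : Metric n M) (q : M) (u w : EuclideanSpace ℝ (Fin n)) :
    koszul g q u u w = christoffelInChart g q (extChartAt (𝓡 n) q q) u w := by
  simp only [koszul, christoffelInChart]
  change (1 / 2 : ℝ) * (fderiv ℝ (metricInChart g q) _ u u w +
    fderiv ℝ (metricInChart g q) _ u u w - fderiv ℝ (metricInChart g q) _ w u u) = _
  ring

theorem metricForm_symm (g : Metric n M) (q : M) (a b : EuclideanSpace ℝ (Fin n)) :
    metricForm g q a b = metricForm g q b a :=
  g.symm q a b

/-- `covDerivAlong` uses the preferred chart at the moving point `γ t`, whereas the ODE is written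
in the single chart at `p`. This law passes between them; its inhomogeneous `ψ''` term is the one
that appears when the velocity is differentiated in the new chart. -/
theorem christoffelInChart_eq_transition (g : Metric n M) (p q : M) {y : EuclideanSpace ℝ (Fin n)}
    (hy : y ∈ (extChartAt (𝓡 n) p).target) (hq : (extChartAt (𝓡 n) p).symm y = q)
    (u w : EuclideanSpace ℝ (Fin n)) :
    christoffelInChart g p y u w =
      koszul g q (chartSymmDeriv p y u) (chartSymmDeriv p y u) (chartSymmDeriv p y w) +
      metricForm g q (fderiv ℝ (fderiv ℝ (transition p q)) y u u) (chartSymmDeriv p y w) := by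
  subst hq
  set q := (extChartAt (𝓡 n) p).symm y with hq
  have hqs : (extChartAt (𝓡 n) p).symm y ∈ (extChartAt (𝓡 n) q).source := mem_extChartAt_source q
  have hψ : transition p q y = extChartAt (𝓡 n) q q := rfl
  rw [chartSymmDeriv_eq_fderiv_transition p hy, koszul_self_apply, ← metricInChart_self, ← hψ]
  refine christoffel_first_kind_pullback
    ((contDiffAt_transition p q hy hqs).of_le (by norm_cast))
    (differentiableAt_metricInChart g p hy)
    (differentiableAt_metricInChart g q ((extChartAt (𝓡 n) q).map_source hqs)) ?_ ?_ u w
  · filter_upwards [eventually_mem_source p q hy hqs] with x hx a b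
    exact metricInChart_eq_pullback g p q hx.1 hx.2 a b
  · intro a b
    rw [hψ, metricInChart_self]
    exact metricForm_symm g q a b

/-- The magnetic geodesic equation in the preferred chart at `p`, for a curve with coordinates `z`,
velocity `u` and acceleration `a`. -/
def SolvesMagneticODE (g : Metric n M) (σ : MagneticField n M) (p : M)
    (z u a : EuclideanSpace ℝ (Fin n)) : Prop :=
  ∀ w, metricInChart g p z a w + christoffelInChart g p z u w = formInChart σ.form p z ![u, w]

theorem velocity_chart_symm (p : M) {z : ℝ → EuclideanSpace ℝ (Fin n)} {t : ℝ}
    {u : EuclideanSpace ℝ (Fin n)} (ht : z t ∈ (extChartAt (𝓡 n) p).target)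
    (hz : HasDerivAt z u t) :
    velocity (fun s => (extChartAt (𝓡 n) p).symm (z s)) t = chartSymmDeriv p (z t) u := by
  have h1 := mfderiv_comp t (mdifferentiableAt_chart_symm p ht)
    hz.differentiableAt.mdifferentiableAt
  have h2 := DFunLike.congr_fun h1 (1 : ℝ)
  refine h2.trans ?_
  rw [mfderiv_eq_fderiv]
  change chartSymmDeriv p (z t) (fderiv ℝ z t 1) = _
  rw [hz.hasFDerivAt.fderiv]
  simp

theorem eq_of_forall_inner_eq (g : Metric n M) (q : M) {v₁ v₂ : TangentSpace (𝓡 n) q}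
    (h : ∀ w, g.inner q v₁ w = g.inner q v₂ w) : v₁ = v₂ := by
  refine sub_eq_zero.1 ((g.bilin_nondegenerate q).1 _ fun w => ?_)
  rw [map_sub, LinearMap.sub_apply]
  exact sub_eq_zero.2 (h w)

/-- A solution of the magnetic geodesic equation in one chart is a magnetic geodesic. -/
theorem isMagneticGeodesicOn_chart_symm (g : Metric n M) (σ : MagneticField n M) (p : M)
    {z u a : ℝ → EuclideanSpace ℝ (Fin n)} {J : Set ℝ} (hJ : IsOpen J) (hsmooth : ContDiffOn ℝ ∞ z J)
    (h : ∀ t ∈ J, HasDerivAt z (u t) t ∧ HasDerivAt u (a t) t ∧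
      z t ∈ (extChartAt (𝓡 n) p).target ∧ SolvesMagneticODE g σ p (z t) (u t) (a t)) :
    IsMagneticGeodesicOn g σ (fun t => (extChartAt (𝓡 n) p).symm (z t)) J := by
  set γ : ℝ → M := fun t => (extChartAt (𝓡 n) p).symm (z t) with hγ
  refine ⟨(contMDiffOn_chart_symm p).comp hsmooth.contMDiffOn fun t ht => (h t ht).2.2.1, ?_⟩
  intro t ht
  obtain ⟨hz, hu, hzt, hsol⟩ := h t ht
  set q : M := γ t with hq
  have hqs : (extChartAt (𝓡 n) p).symm (z t) ∈ (extChartAt (𝓡 n) q).source :=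
    mem_extChartAt_source q
  set L := chartSymmDeriv p (z t) with hL
  set ψ := transition (n := n) p q with hψ
  have hLψ : L = fderiv ℝ ψ (z t) := chartSymmDeriv_eq_fderiv_transition p hzt
  have hev : ∀ᶠ s in 𝓝 t, s ∈ J ∧ γ s ∈ (extChartAt (𝓡 n) q).source := by
    refine (Filter.eventually_mem_set.2 (hJ.mem_nhds ht)).and ?_
    exact (hz.continuousAt.eventually (eventually_mem_source p q hzt hqs)).mono fun s hs => hs.2
  -- With `q = γ t` frozen, the velocity near time `t` has coordinates `ψ' (z) u` in the chart at
  -- `q`; its derivative is `ψ'' (u, u) + L a`.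
  have hcoord : (fun s => (mfderiv (𝓡 n) 𝓘(ℝ, EuclideanSpace ℝ (Fin n)) (extChartAt (𝓡 n) q) (γ s)
      (velocity (n := n) γ s) : EuclideanSpace ℝ (Fin n))) =ᶠ[𝓝 t] fun s => fderiv ℝ ψ (z s) (u s) := by
    filter_upwards [hev] with s hs
    obtain ⟨hzs, -, hzst, -⟩ := h s hs.1
    rw [velocity_chart_symm p hzst hzs]
    have h1 : MDifferentiableAt (𝓡 n) 𝓘(ℝ, EuclideanSpace ℝ (Fin n)) (extChartAt (𝓡 n) q)
        ((extChartAt (𝓡 n) p).symm (z s)) :=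
      mdifferentiableAt_extChartAt (by have := hs.2; rwa [extChartAt_source] at this)
    have h2 := mfderiv_comp (z s) h1 (mdifferentiableAt_chart_symm p hzst)
    have h3 := DFunLike.congr_fun h2 (u s)
    refine h3.symm.trans ?_
    change mfderiv 𝓘(ℝ, EuclideanSpace ℝ (Fin n)) 𝓘(ℝ, EuclideanSpace ℝ (Fin n)) ψ (z s) (u s) = _
    rw [mfderiv_eq_fderiv]
    rfl
  have hψ2 : HasFDerivAt (fderiv ℝ ψ) (fderiv ℝ (fderiv ℝ ψ) (z t)) (z t) :=
    (((contDiffAt_transition p q hzt hqs).fderiv_right (m := 1) (by norm_cast)).differentiableAt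
      (by norm_num)).hasFDerivAt
  have hderiv : HasDerivAt (fun s => fderiv ℝ ψ (z s) (u s))
      (fderiv ℝ (fderiv ℝ ψ) (z t) (u t) (u t) + L (a t)) t := by
    rw [hLψ]
    exact (hψ2.comp_hasDerivAt t hz).clm_apply hu
  let A : TangentSpace (𝓡 n) q := fderiv ℝ (fderiv ℝ ψ) (z t) (u t) (u t) + L (a t)
  let v : TangentSpace (𝓡 n) q := L (u t)
  have hv : velocity γ t = v := velocity_chart_symm p hzt hz
  have hcd : covDerivAlong g γ (velocity (n := n) γ) t = A + christoffel g q v v :=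
    congrArg₂ (fun X V : TangentSpace (𝓡 n) q => X + christoffel g q V V)
      (hcoord.deriv_eq.trans hderiv.deriv) hv
  rw [hcd, hv]
  refine eq_of_forall_inner_eq g q fun w => ?_
  obtain ⟨w', rfl⟩ : ∃ w', L w' = w := by
    obtain ⟨e, he⟩ := isInvertible_chartSymmDeriv p hzt
    exact ⟨e.symm w, by rw [hL, ← he]; exact e.apply_symm_apply w⟩
  have h5 := hsol w'
  rw [formInChart_apply, christoffelInChart_eq_transition g p q hzt rfl, metricInChart_apply] at h5
  -- The `ψ''` term of the transformed Christoffel symbol joins `L (a t)` to form `A`.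
  have h6 : metricForm g q A (L w') + koszul g q v v (L w') = σ.form q ![v, L w'] := by
    refine Eq.trans ?_ h5
    change metricForm g q (_ + L (a t)) (L w') + _ = metricForm g q (L (a t)) (L w') + _
    rw [map_add, add_apply, add_assoc, add_left_comm]
    exact congrArg (metricForm g q (L (a t)) (L w') + ·) (add_comm _ _)
  refine Eq.trans ?_ (h6.trans (inner_lorentzForce g σ q v (L w')).symm)
  refine Eq.trans (DFunLike.congr_fun (map_add (g.inner q) A (christoffel g q v v)) (L w')) ?_
  exact congrArg (metricForm g q A (L w') + ·) (inner_sharp g q (koszul g q v v) (L w'))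

end MagneticGeometry
end

/-! ### The acceleration as a smooth function of position and velocity. -/

noncomputable section

set_option maxSynthPendingDepth 3 in
theorem contDiffOn_christoffel_first_kind {E : Type*} [NormedAddCommGroup E] [NormedSpace ℝ E]
    {G : E → E →L[ℝ] E →L[ℝ] ℝ} {U : Set E} (hU : IsOpen U) (hG : ContDiffOn ℝ ∞ G U) (w : E) :
    ContDiffOn ℝ ∞ (fun x : E × E =>
      fderiv ℝ G x.1 x.2 x.2 w - 1 / 2 * fderiv ℝ G x.1 w x.2 x.2) (U ×ˢ univ) := by
  have hG' : ContDiffOn ℝ ∞ (fun x : E × E => fderiv ℝ G x.1) (U ×ˢ univ) :=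
    (hG.fderiv_of_isOpen hU (by simp)).comp contDiffOn_fst fun x hx => hx.1
  have h2 : ContDiffOn ℝ ∞ (fun x : E × E => x.2) (U ×ˢ univ) := contDiffOn_snd
  exact (((hG'.clm_apply h2).clm_apply h2).clm_apply contDiffOn_const).sub
    (contDiffOn_const.mul (((hG'.clm_apply contDiffOn_const).clm_apply h2).clm_apply h2))

namespace MagneticGeometry

variable {n : ℕ} {M : Type*} [TopologicalSpace M] [ChartedSpace (EuclideanSpace ℝ (Fin n)) M]

theorem contDiffOn_formInChart_apply (σ : MagneticField n M) (p : M)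
    (w : EuclideanSpace ℝ (Fin n)) :
    ContDiffOn ℝ ∞ (fun x : EuclideanSpace ℝ (Fin n) × EuclideanSpace ℝ (Fin n) =>
      formInChart σ.form p x.1 ![x.2, w]) ((extChartAt (𝓡 n) p).target ×ˢ univ) := by
  let B : EuclideanSpace ℝ (Fin n) → EuclideanSpace ℝ (Fin n) →L[ℝ] ℝ := fun y =>
    LinearMap.toContinuousLinearMap
      { toFun := fun u => formInChart σ.form p y ![u, w]
        map_add' := fun u u' => by
          have h := (formInChart σ.form p y).map_update_add ![u, w] 0 u u'
          simpa only [update_pair_zero] using h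
        map_smul' := fun c u => by
          have h := (formInChart σ.form p y).map_update_smul ![u, w] 0 c u
          simpa only [update_pair_zero, RingHom.id_apply] using h }
  have hB : ContDiffOn ℝ ∞ B (extChartAt (𝓡 n) p).target := by
    refine contDiffOn_clm_apply.2 fun u => ?_
    exact (ContinuousAlternatingMap.apply ℝ _ ℝ ![u, w]).contDiff.comp_contDiffOn (σ.smooth p)
  exact (hB.comp contDiffOn_fst fun x hx => hx.1).clm_apply contDiffOn_snd

variable [IsManifold (𝓡 n) ∞ M]

/-- Positive definiteness gives injectivity, and the dual space has the same dimension.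
Invertibility allows the equation to be solved for the acceleration. -/
theorem isInvertible_metricInChart (g : Metric n M) (p : M) {y : EuclideanSpace ℝ (Fin n)}
    (hy : y ∈ (extChartAt (𝓡 n) p).target) : (metricInChart g p y).IsInvertible := by
  have hinj : Function.Injective (metricInChart g p y).toLinearMap := by
    rw [← LinearMap.ker_eq_bot, LinearMap.ker_eq_bot']
    intro a ha
    by_contra hne
    have hLa : chartSymmDeriv p y a ≠ 0 := by
      obtain ⟨e, he⟩ := isInvertible_chartSymmDeriv p hy
      rw [← he]
      exact fun h => hne (e.map_eq_zero_iff.1 h)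
    have h1 : metricInChart g p y a a = 0 := DFunLike.congr_fun ha a
    exact (g.pos _ (chartSymmDeriv p y a) hLa).ne' h1
  have hdim : Module.finrank ℝ (EuclideanSpace ℝ (Fin n)) =
      Module.finrank ℝ (EuclideanSpace ℝ (Fin n) →L[ℝ] ℝ) := by
    rw [← (LinearMap.toContinuousLinearMap (𝕜 := ℝ) (E := EuclideanSpace ℝ (Fin n))
      (F' := ℝ)).finrank_eq]
    exact (Subspace.dual_finrank_eq (K := ℝ)).symm
  refine ⟨(LinearEquiv.ofInjectiveOfFinrankEq _ hinj hdim).toContinuousLinearEquiv, ?_⟩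
  ext1 a
  rfl

set_option maxSynthPendingDepth 3 in
/-- The right hand side `w ↦ σ (u, w) - Γ (u, u, w)` of the magnetic geodesic equation in the
preferred chart at `p`, at the point `x.1` and for the velocity `x.2`. -/
def magneticCovector (g : Metric n M) (σ : MagneticField n M) (p : M)
    (x : EuclideanSpace ℝ (Fin n) × EuclideanSpace ℝ (Fin n)) :
    EuclideanSpace ℝ (Fin n) →L[ℝ] ℝ :=
  LinearMap.toContinuousLinearMap
    { toFun := fun w => formInChart σ.form p x.1 ![x.2, w] - christoffelInChart g p x.1 x.2 w
      map_add' := fun w w' => by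
        have h := (formInChart σ.form p x.1).map_update_add ![x.2, w] 1 w w'
        simp only [update_pair_one] at h
        simp only [h, christoffelInChart, map_add, add_apply]
        ring
      map_smul' := fun c w => by
        have h := (formInChart σ.form p x.1).map_update_smul ![x.2, w] 1 c w
        simp only [update_pair_one] at h
        simp only [h, christoffelInChart, map_smul, smul_apply, smul_eq_mul, RingHom.id_apply]
        ring }

theorem magneticCovector_apply (g : Metric n M) (σ : MagneticField n M) (p : M)
    (x : EuclideanSpace ℝ (Fin n) × EuclideanSpace ℝ (Fin n)) (w : EuclideanSpace ℝ (Fin n)) :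
    magneticCovector g σ p x w =
      formInChart σ.form p x.1 ![x.2, w] - christoffelInChart g p x.1 x.2 w := rfl

/-- The acceleration of the magnetic geodesics in the preferred chart at `p`, as a function of
position and velocity. -/
def magneticAcceleration (g : Metric n M) (σ : MagneticField n M) (p : M)
    (x : EuclideanSpace ℝ (Fin n) × EuclideanSpace ℝ (Fin n)) : EuclideanSpace ℝ (Fin n) :=
  (metricInChart g p x.1).inverse (magneticCovector g σ p x)

theorem solvesMagneticODE_magneticAcceleration (g : Metric n M) (σ : MagneticField n M) (p : M)
    {x : EuclideanSpace ℝ (Fin n) × EuclideanSpace ℝ (Fin n)}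
    (hx : x.1 ∈ (extChartAt (𝓡 n) p).target) :
    SolvesMagneticODE g σ p x.1 x.2 (magneticAcceleration g σ p x) := by
  intro w
  have : metricInChart g p x.1 (magneticAcceleration g σ p x) = magneticCovector g σ p x := by
    obtain ⟨e, he⟩ := isInvertible_metricInChart g p hx
    rw [magneticAcceleration, ← he, ContinuousLinearMap.inverse_equiv]
    exact e.apply_symm_apply _
  rw [this, magneticCovector_apply]
  ring

-- The acceleration is the sum of a part linear and a part quadratic in the velocity, so every point
-- at rest is an equilibrium.
set_option maxSynthPendingDepth 3 in
theorem magneticAcceleration_zero (g : Metric n M) (σ : MagneticField n M) (p : M)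
    (y : EuclideanSpace ℝ (Fin n)) : magneticAcceleration g σ p (y, 0) = 0 := by
  have : magneticCovector g σ p (y, 0) = 0 := by
    ext1 w
    have h := (formInChart σ.form p y).map_coord_zero (m := ![0, w]) 0 rfl
    rw [magneticCovector_apply, h]
    simp [christoffelInChart]
  rw [magneticAcceleration, this, map_zero]

set_option maxSynthPendingDepth 3 in
theorem contDiffOn_magneticCovector (g : Metric n M) (σ : MagneticField n M) (p : M) :
    ContDiffOn ℝ ∞ (magneticCovector g σ p) ((extChartAt (𝓡 n) p).target ×ˢ univ) := by
  refine contDiffOn_clm_apply.2 fun w => ?_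
  simp only [magneticCovector_apply, christoffelInChart]
  exact (contDiffOn_formInChart_apply σ p w).sub
    (contDiffOn_christoffel_first_kind (isOpen_target p) (contDiffOn_metricInChart g p) w)

theorem contDiffOn_magneticAcceleration (g : Metric n M) (σ : MagneticField n M) (p : M) :
    ContDiffOn ℝ ∞ (magneticAcceleration g σ p) ((extChartAt (𝓡 n) p).target ×ˢ univ) := by
  intro x hx
  obtain ⟨e, he⟩ := isInvertible_metricInChart g p hx.1
  have h1 : ContDiffWithinAt ℝ ∞ (fun x : EuclideanSpace ℝ (Fin n) × EuclideanSpace ℝ (Fin n) =>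
      (metricInChart g p x.1).inverse) ((extChartAt (𝓡 n) p).target ×ˢ univ) x := by
    refine ContDiffAt.comp_contDiffWithinAt x (g := ContinuousLinearMap.inverse)
      (he ▸ contDiffAt_map_inverse e) ?_
    exact (contDiffOn_metricInChart g p).comp contDiffOn_fst (fun x hx => hx.1) x hx
  exact h1.clm_apply (contDiffOn_magneticCovector g σ p x hx)

end MagneticGeometry
end

/-! ### Linear algebra and inverse-function tools for the local normal form. -/

noncomputable section

section LocalNormalForm

/-- A decomposition of the identity adapted to the intersection of two preimages of subspaces. -/
theorem exists_decomposition_of_comap_inf_comap {E F₁ F₂ : Type*} [NormedAddCommGroup E]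
    [NormedSpace ℝ E] [FiniteDimensional ℝ E] [NormedAddCommGroup F₁] [NormedSpace ℝ F₁]
    [FiniteDimensional ℝ F₁] [NormedAddCommGroup F₂] [NormedSpace ℝ F₂] [FiniteDimensional ℝ F₂]
    (A₁ : E →L[ℝ] F₁) (A₂ : E →L[ℝ] F₂) (W₁ : Submodule ℝ F₁) (W₂ : Submodule ℝ F₂) :
    ∃ (P : E →L[ℝ] E) (D₁ : F₁ →L[ℝ] E) (D₂ : F₂ →L[ℝ] E),
      (∀ x, A₁ (P x) ∈ W₁ ∧ A₂ (P x) ∈ W₂) ∧ (∀ w ∈ W₁, D₁ w = 0) ∧ (∀ w ∈ W₂, D₂ w = 0) ∧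
      ∀ x, P x + D₁ (A₁ x) + D₂ (A₂ x) = x := by
  -- `R` measures the failure to lie in both preimages. A left inverse of `R` on a complement of its
  -- kernel gives `Q`; then `P = id - Q R` projects onto the kernel, and each `Dᵢ` factors through
  -- the quotient by `Wᵢ`.
  let R : E →ₗ[ℝ] (F₁ ⧸ W₁) × (F₂ ⧸ W₂) :=
    (W₁.mkQ ∘ₗ A₁.toLinearMap).prod (W₂.mkQ ∘ₗ A₂.toLinearMap)
  have hR : ∀ x, R x = 0 ↔ A₁ x ∈ W₁ ∧ A₂ x ∈ W₂ := by
    intro x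
    simp [R, Prod.ext_iff, Submodule.Quotient.mk_eq_zero]
  obtain ⟨S, hS⟩ := Submodule.exists_isCompl (LinearMap.ker R)
  have hinj : LinearMap.ker (R ∘ₗ S.subtype) = ⊥ := by
    rw [LinearMap.ker_eq_bot']
    intro s hs
    have : (s : E) ∈ LinearMap.ker R ⊓ S := ⟨hs, s.2⟩
    rw [hS.inf_eq_bot] at this
    exact Subtype.ext this
  obtain ⟨C, hC⟩ := LinearMap.exists_leftInverse_of_injective _ hinj
  let Q : (F₁ ⧸ W₁) × (F₂ ⧸ W₂) →ₗ[ℝ] E := S.subtype ∘ₗ C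
  let D₁ : F₁ →ₗ[ℝ] E := Q ∘ₗ LinearMap.inl ℝ _ _ ∘ₗ W₁.mkQ
  let D₂ : F₂ →ₗ[ℝ] E := Q ∘ₗ LinearMap.inr ℝ _ _ ∘ₗ W₂.mkQ
  have hQ : ∀ x, D₁ (A₁ x) + D₂ (A₂ x) = Q (R x) := by
    intro x
    simp only [D₁, D₂, LinearMap.comp_apply, ← map_add]
    congr 1
    simp [R]
  refine ⟨LinearMap.toContinuousLinearMap (LinearMap.id - Q ∘ₗ R), LinearMap.toContinuousLinearMap D₁,
    LinearMap.toContinuousLinearMap D₂, ?_, ?_, ?_, ?_⟩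
  · intro x
    rw [← hR]
    obtain ⟨t, ht, s, hs, rfl⟩ := Submodule.mem_sup.1
      (hS.sup_eq_top.symm ▸ Submodule.mem_top : x ∈ LinearMap.ker R ⊔ S)
    have h1 : Q (R s) = s := congrArg Subtype.val (DFunLike.congr_fun hC (⟨s, hs⟩ : S))
    have h2 : R t = 0 := ht
    simp [h1, h2]
  · intro w hw
    have : W₁.mkQ w = 0 := by simpa using hw
    simp only [LinearMap.coe_toContinuousLinearMap', D₁, LinearMap.comp_apply, this, map_zero]
  · intro w hw
    have : W₂.mkQ w = 0 := by simpa using hw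
    simp only [LinearMap.coe_toContinuousLinearMap', D₂, LinearMap.comp_apply, this, map_zero]
  · intro x
    simp only [LinearMap.coe_toContinuousLinearMap', LinearMap.sub_apply, LinearMap.comp_apply,
      LinearMap.id_apply]
    rw [add_assoc, hQ]
    abel

variable {E : Type*} [NormedAddCommGroup E] [NormedSpace ℝ E]

/-- A smooth map whose derivative at a point is the identity is a smooth local diffeomorphism. -/
theorem exists_smooth_openPartialHomeomorph [CompleteSpace E] {f : E → E} {U : Set E}
    (hU : IsOpen U) {y : E} (hy : y ∈ U) (hf : ContDiffOn ℝ ∞ f U)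
    (hf' : HasFDerivAt f (ContinuousLinearMap.id ℝ E) y) :
    ∃ Φ : OpenPartialHomeomorph E E, (Φ : E → E) = f ∧ y ∈ Φ.source ∧ Φ.source ⊆ U ∧
      ContDiffOn ℝ ∞ Φ.symm Φ.target := by
  have hfy : ContDiffAt ℝ ∞ f y := hf.contDiffAt (hU.mem_nhds hy)
  have hcont : ContinuousOn (fderiv ℝ f) U := hf.continuousOn_fderiv_of_isOpen hU (by simp)
  -- Restricting to the open set where the derivative is invertible makes the inverse smooth on its
  -- whole domain, not only at the image of `y`.
  let V : Set E := U ∩ fderiv ℝ f ⁻¹' range ((↑) : (E ≃L[ℝ] E) → E →L[ℝ] E)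
  have hV : IsOpen V := hcont.isOpen_inter_preimage hU ContinuousLinearEquiv.isOpen
  have hyV : y ∈ V := ⟨hy, ContinuousLinearEquiv.refl ℝ E, by rw [hf'.fderiv]; rfl⟩
  have hf'' : HasFDerivAt f ((ContinuousLinearEquiv.refl ℝ E : E ≃L[ℝ] E) : E →L[ℝ] E) y := hf'
  let Ψ := hfy.toOpenPartialHomeomorph f hf'' (by simp)
  refine ⟨Ψ.restrOpen V hV, rfl,
    ⟨hfy.mem_toOpenPartialHomeomorph_source hf'' (by simp), hyV⟩, fun x hx => hx.2.1, ?_⟩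
  intro x hx
  have hmem : (Ψ.restrOpen V hV).symm x ∈ V := ((Ψ.restrOpen V hV).map_target hx).2
  obtain ⟨e, he⟩ := hmem.2
  have hsm : ContDiffAt ℝ ∞ f ((Ψ.restrOpen V hV).symm x) := hf.contDiffAt (hU.mem_nhds hmem.1)
  refine (OpenPartialHomeomorph.contDiffAt_symm (f₀' := e) _ hx ?_ hsm).contDiffWithinAt
  rw [he]
  exact (hsm.differentiableAt (by simp)).hasFDerivAt

/-- If `Z v` is close to `y + τ v` in the `C¹` sense, `f` is tangent to `x ↦ x - y` at `y` and
`f ∘ Z` maps a ball of the subspace `T` into `T`, then it covers a neighbourhood of zero in `T`. -/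
theorem eventually_exists_eq_of_approximates {f Z : E → E} {y : E} {τ r : ℝ} (hτ : 0 < τ)
    (hr : 0 < r) (T : Submodule ℝ E) [FiniteDimensional ℝ E]
    (hf : HasStrictFDerivAt f (ContinuousLinearMap.id ℝ E) y) (hfy : f y = 0) (hZ0 : Z 0 = y)
    (hZ : ∀ v ∈ Metric.ball (0 : E) r, ∀ w ∈ Metric.ball (0 : E) r,
      ‖Z v - Z w - τ • (v - w)‖ ≤ 1 / 4 * τ * ‖v - w‖)
    (hT : ∀ v ∈ T, v ∈ Metric.ball (0 : E) r → f (Z v) ∈ T) :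
    ∀ᶠ x in 𝓝 (0 : E), x ∈ T → ∃ v ∈ T, v ∈ Metric.ball (0 : E) r ∧ f (Z v) = x := by
  have : CompleteSpace E := FiniteDimensional.complete ℝ E
  obtain ⟨s, hs, hfs⟩ := hf.approximates_deriv_on_nhds (c := 1 / 4) (Or.inr (by norm_num))
  have hZle : ∀ v ∈ Metric.ball (0 : E) r, ∀ w ∈ Metric.ball (0 : E) r,
      ‖Z v - Z w‖ ≤ 5 / 4 * τ * ‖v - w‖ := by
    intro v hv w hw
    calc ‖Z v - Z w‖ = ‖(Z v - Z w - τ • (v - w)) + τ • (v - w)‖ := by rw [sub_add_cancel]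
      _ ≤ ‖Z v - Z w - τ • (v - w)‖ + ‖τ • (v - w)‖ := norm_add_le _ _
      _ ≤ 1 / 4 * τ * ‖v - w‖ + τ * ‖v - w‖ := by
        gcongr
        · exact hZ v hv w hw
        · rw [norm_smul, Real.norm_of_nonneg hτ.le]
      _ = _ := by ring
  have hr0 : (0 : E) ∈ Metric.ball (0 : E) r := Metric.mem_ball_self hr
  have hZc : ContinuousAt Z 0 := by
    rw [ContinuousAt, tendsto_iff_norm_sub_tendsto_zero]
    refine squeeze_zero' (Eventually.of_forall fun _ => norm_nonneg _)
      ((Filter.eventually_mem_set.2 (Metric.ball_mem_nhds 0 hr)).mono fun v hv => hZle v hv 0 hr0) ?_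
    have : Continuous fun v : E => 5 / 4 * τ * ‖v - 0‖ := by fun_prop
    simpa using this.tendsto 0
  obtain ⟨r', hr', hr's⟩ := Metric.mem_nhds_iff.1
    (inter_mem (Metric.ball_mem_nhds (0 : E) hr) (hZc.preimage_mem_nhds (hZ0.symm ▸ hs)))
  obtain ⟨pr, hpr⟩ := T.subtype.exists_leftInverse_of_injective T.ker_subtype
  have hpr' : ∀ x (hx : x ∈ T), pr x = ⟨x, hx⟩ := fun x hx => DFunLike.congr_fun hpr ⟨x, hx⟩
  -- The rescaled `f ∘ Z` as a self-map of `T`; the projection `pr` serves only to define it on all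
  -- of `T`.
  let G : T → T := fun v => τ⁻¹ • pr (f (Z v))
  have hG : ∀ v : T, (v : E) ∈ Metric.ball (0 : E) r → (G v : E) = τ⁻¹ • f (Z v) := by
    intro v hv
    simp only [G, hpr' _ (hT v v.2 hv), Submodule.coe_smul]
  -- `9 / 16 = 1 / 4 · 5 / 4 + 1 / 4`: the error of `f` on differences of `Z`, plus the error of
  -- `Z`. Being less than `1`, it makes `G` open at `0`.
  have happ : ApproximatesLinearOn G (ContinuousLinearMap.id ℝ T) (Metric.ball (0 : T) r')
      (9 / 16) := by
    intro v hv w hw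
    have hv' : (v : E) ∈ Metric.ball (0 : E) r' := by simpa using hv
    have hw' : (w : E) ∈ Metric.ball (0 : E) r' := by simpa using hw
    obtain ⟨hvr, hvs⟩ := hr's hv'
    obtain ⟨hwr, hws⟩ := hr's hw'
    have h1 := hfs (Z v) hvs (Z w) hws
    have h2 := hZ v hvr w hwr
    have h3 := hZle v hvr w hwr
    have h4 : ((G v - G w - ContinuousLinearMap.id ℝ T (v - w) : T) : E) =
        τ⁻¹ • ((f (Z v) - f (Z w) - (Z v - Z w)) + (Z v - Z w - τ • ((v : E) - w))) := by
      rw [sub_add_sub_cancel, smul_sub, inv_smul_smul₀ hτ.ne']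
      simp [hG v hvr, hG w hwr, smul_sub]
    change ‖((G v - G w - ContinuousLinearMap.id ℝ T (v - w) : T) : E)‖ ≤ _
    rw [h4, norm_smul, norm_inv, Real.norm_of_nonneg hτ.le, inv_mul_le_iff₀ hτ]
    refine (norm_add_le _ _).trans ?_
    have h5 : ((9 / 16 : NNReal) : ℝ) = 9 / 16 := by norm_num
    have h6 : ((1 / 4 : NNReal) : ℝ) = 1 / 4 := by norm_num
    rw [h6] at h1
    have h7 : ‖(v - w : T)‖ = ‖(v : E) - w‖ := rfl
    rw [h5, h7]
    simp only [ContinuousLinearMap.id_apply] at h1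
    nlinarith
  let I : (ContinuousLinearMap.id ℝ T).NonlinearRightInverse :=
    ⟨id, 1, fun y => by simp, fun y => rfl⟩
  have himg := happ.image_mem_nhds I (Metric.ball_mem_nhds 0 hr') (Or.inr (by
    change (9 / 16 : NNReal) < 1⁻¹
    rw [inv_one, ← NNReal.coe_lt_coe]
    norm_num))
  have hG0 : G 0 = 0 := by
    apply Subtype.ext
    rw [hG 0 (by simpa using hr)]
    simp [hZ0, hfy]
  rw [hG0, Metric.mem_nhds_iff] at himg
  obtain ⟨ρ, hρ, hρG⟩ := himg
  filter_upwards [Metric.ball_mem_nhds (0 : E) (mul_pos hτ hρ)] with x hx hxT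
  obtain ⟨v, hv, hvx⟩ := hρG (show (τ⁻¹ • (⟨x, hxT⟩ : T)) ∈ Metric.ball (0 : T) ρ by
    rw [mem_ball_zero_iff] at hx ⊢
    rw [norm_smul, norm_inv, Real.norm_of_nonneg hτ.le, inv_mul_lt_iff₀ hτ]
    exact hx)
  have hvr : (v : E) ∈ Metric.ball (0 : E) r := (hr's (by simpa using hv)).1
  refine ⟨v, v.2, hvr, ?_⟩
  have := congrArg Subtype.val hvx
  rw [hG v hvr] at this
  exact smul_right_injective E (inv_ne_zero hτ.ne') this

/-- The derivative of a curve in a closed subspace lies in this subspace. -/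
theorem HasDerivAt.mem_submodule [FiniteDimensional ℝ E] {c : ℝ → E} {c' : E} {t : ℝ}
    (h : HasDerivAt c c' t) (W : Submodule ℝ E) (hW : ∀ᶠ s in 𝓝 t, c s ∈ W) : c' ∈ W := by
  refine W.closed_of_finiteDimensional.mem_of_tendsto (hasDerivAt_iff_tendsto_slope.1 h) ?_
  filter_upwards [nhdsWithin_le_nhds hW] with s hs
  exact W.smul_mem _ (W.sub_mem hs hW.self_of_nhds)

end LocalNormalForm
end

/-! ### Slice charts, tangent spaces, and geodesics that stay in a submanifold. -/

noncomputable section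

namespace MagneticGeometry

variable {n : ℕ} {M : Type*} [TopologicalSpace M] [ChartedSpace (EuclideanSpace ℝ (Fin n)) M]

/-- A slice chart of `N`: a smooth chart which carries `N` to the linear subspace `W`. -/
structure IsSliceChart (φ : OpenPartialHomeomorph M (EuclideanSpace ℝ (Fin n)))
    (W : Submodule ℝ (EuclideanSpace ℝ (Fin n))) (N : Set M) : Prop where
  mem_maximalAtlas : φ ∈ IsManifold.maximalAtlas (𝓡 n) ∞ M
  mem_iff : ∀ q ∈ φ.source, q ∈ N ↔ φ q ∈ W

/-- The derivative of a chart `φ` at `p`. -/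
def chartDeriv (φ : OpenPartialHomeomorph M (EuclideanSpace ℝ (Fin n))) (p : M) :
    EuclideanSpace ℝ (Fin n) →L[ℝ] EuclideanSpace ℝ (Fin n) :=
  mfderiv (𝓡 n) 𝓘(ℝ, EuclideanSpace ℝ (Fin n)) φ p

variable {φ : OpenPartialHomeomorph M (EuclideanSpace ℝ (Fin n))}
  {W : Submodule ℝ (EuclideanSpace ℝ (Fin n))} {N : Set M}

theorem mdifferentiable_of_mem_maximalAtlas (hφ : φ ∈ IsManifold.maximalAtlas (𝓡 n) ∞ M) :
    φ.MDifferentiable (𝓡 n) 𝓘(ℝ, EuclideanSpace ℝ (Fin n)) :=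
  ⟨(contMDiffOn_of_mem_maximalAtlas hφ).mdifferentiableOn (by simp),
    (contMDiffOn_symm_of_mem_maximalAtlas hφ).mdifferentiableOn (by simp)⟩

theorem chartDeriv_injective (hφ : φ ∈ IsManifold.maximalAtlas (𝓡 n) ∞ M) {p : M}
    (hp : p ∈ φ.source) : Function.Injective (chartDeriv φ p) := by
  have h := (mdifferentiable_of_mem_maximalAtlas hφ).symm_comp_deriv hp
  exact Function.LeftInverse.injective
    (g := mfderiv 𝓘(ℝ, EuclideanSpace ℝ (Fin n)) (𝓡 n) φ.symm (φ p)) fun v => DFunLike.congr_fun h v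

theorem hasDerivAt_chart_comp (hφ : φ ∈ IsManifold.maximalAtlas (𝓡 n) ∞ M) {c : ℝ → M} {t : ℝ}
    (hc : MDifferentiableAt 𝓘(ℝ, ℝ) (𝓡 n) c t) (ht : c t ∈ φ.source) :
    HasDerivAt (fun s => φ (c s)) (chartDeriv φ (c t) (velocity c t)) t := by
  have h1 : MDifferentiableAt (𝓡 n) 𝓘(ℝ, EuclideanSpace ℝ (Fin n)) φ (c t) :=
    (mdifferentiable_of_mem_maximalAtlas hφ).mdifferentiableAt ht
  have h2 := (h1.comp t hc).differentiableAt.hasDerivAt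
  have h3 := DFunLike.congr_fun (mfderiv_comp t h1 hc) (1 : ℝ)
  rw [mfderiv_eq_fderiv] at h3
  convert! h2 using 1
  exact h3.symm

/-- The tangent space of a submanifold in a slice chart. -/
theorem IsSliceChart.mem_tangentSpaceOf_iff (h : IsSliceChart φ W N) {p : M} (hp : p ∈ φ.source)
    (hpN : p ∈ N) (v : TangentSpace (𝓡 n) p) :
    v ∈ tangentSpaceOf N p ↔ chartDeriv φ p v ∈ W := by
  constructor
  · rintro ⟨c, rfl, hc, hcN, rfl⟩
    refine (hasDerivAt_chart_comp h.mem_maximalAtlas (hc.mdifferentiableAt (by simp))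
      hp).mem_submodule W ?_
    filter_upwards [hcN, hc.continuousAt.preimage_mem_nhds (φ.open_source.mem_nhds hp)] with t h1 h2
    exact (h.mem_iff _ h2).1 h1
  · intro hv
    set w : EuclideanSpace ℝ (Fin n) := chartDeriv φ p v with hw
    let l : ℝ → EuclideanSpace ℝ (Fin n) := fun t => φ p + t • w
    have hl0 : l 0 = φ p := by simp [l]
    have hlc : ContDiff ℝ ∞ l := by fun_prop
    have hl' : HasDerivAt l w 0 := by
      simpa [l] using ((hasDerivAt_id (0 : ℝ)).smul_const w).const_add (φ p)
    have hpt : l 0 ∈ φ.target := hl0 ▸ φ.map_source hp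
    have hsymm := contMDiffAt_symm_of_mem_maximalAtlas h.mem_maximalAtlas hpt
    refine ⟨fun t => φ.symm (l t), ?_, ?_, ?_, ?_⟩
    · simp only [hl0]
      exact φ.left_inv hp
    · exact ContMDiffAt.comp (0 : ℝ) hsymm hlc.contMDiff.contMDiffAt
    · filter_upwards [hlc.continuous.continuousAt.preimage_mem_nhds
        (φ.open_target.mem_nhds hpt)] with t ht
      rw [h.mem_iff _ (φ.map_target ht), φ.right_inv ht]
      exact W.add_mem ((h.mem_iff p hp).1 hpN) (W.smul_mem _ hv)
    · have h1 := mfderiv_comp (0 : ℝ) (hsymm.mdifferentiableAt (by simp))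
        hl'.differentiableAt.mdifferentiableAt
      have h2 := DFunLike.congr_fun h1 (1 : ℝ)
      refine h2.trans ?_
      rw [mfderiv_eq_fderiv]
      change mfderiv 𝓘(ℝ, EuclideanSpace ℝ (Fin n)) (𝓡 n) φ.symm (l 0) (fderiv ℝ l 0 1) = v
      rw [hl'.hasFDerivAt.fderiv, hl0]
      have h3 := (mdifferentiable_of_mem_maximalAtlas h.mem_maximalAtlas).symm_comp_deriv hp
      have h4 := DFunLike.congr_fun h3 v
      refine Eq.trans ?_ h4
      exact congrArg (mfderiv 𝓘(ℝ, EuclideanSpace ℝ (Fin n)) (𝓡 n) φ.symm (φ p))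
        (one_smul ℝ w)

variable [IsManifold (𝓡 n) ∞ M]

/-- A magnetic geodesic which starts tangentially to a totally magnetic submanifold does not leave
it within a slice chart. -/
theorem IsSliceChart.mem_of_isMagneticGeodesicOn {g : Metric n M} {σ : MagneticField n M}
    (h : IsSliceChart φ W N) (hN : IsTotallyMagnetic g σ N) {γ : ℝ → M} {J : Set ℝ}
    (hJ : IsOpen J) (hJc : J.OrdConnected) (h0 : (0 : ℝ) ∈ J)
    (hγ : ContMDiffOn 𝓘(ℝ, ℝ) (𝓡 n) ∞ γ J)
    (hgeo : ∀ s, IsMagneticGeodesicOn g σ (fun t => γ (t + s)) ((· + s) ⁻¹' J))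
    (hsource : ∀ t ∈ J, γ t ∈ φ.source) (hγ0 : φ (γ 0) ∈ W)
    (hγ0' : deriv (fun t => φ (γ t)) 0 ∈ W) : ∀ t ∈ J, γ t ∈ N := by
  set f : ℝ → EuclideanSpace ℝ (Fin n) := fun t => φ (γ t) with hf
  have hfc : ContDiffOn ℝ ∞ f J := by
    rw [← contMDiffOn_iff_contDiffOn]
    exact (contMDiffOn_of_mem_maximalAtlas h.mem_maximalAtlas).comp hγ hsource
  have hf0 : ContinuousOn f J := hfc.continuousOn
  have hf1 : ContinuousOn (deriv f) J := hfc.continuousOn_deriv_of_isOpen hJ (by simp)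
  have hW : IsClosed (W : Set (EuclideanSpace ℝ (Fin n))) := W.closed_of_finiteDimensional
  -- An open-closed argument on the interval `J`. Tangency is recorded along with membership, since
  -- the totally magnetic condition can be reapplied only at a time where the velocity is tangent to
  -- `N`.
  let B : Set ℝ := {t | t ∈ J ∧ f t ∈ W ∧ deriv f t ∈ W}
  have hsmooth : ∀ t ∈ J, ContMDiffAt 𝓘(ℝ, ℝ) (𝓡 n) ∞ γ t := fun t ht =>
    hγ.contMDiffAt (hJ.mem_nhds ht)
  have hB : IsOpen B := by
    rw [isOpen_iff_mem_nhds]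
    rintro s ⟨hs, hs1, hs2⟩
    let c : ℝ → M := fun t => γ (t + s)
    have hc0 : c 0 = γ s := by simp [c]
    have hcs : c 0 ∈ φ.source := hc0 ▸ hsource s hs
    have hcN : c 0 ∈ N := by
      rw [h.mem_iff _ hcs, hc0]
      exact hs1
    have hcJ : (0 : ℝ) ∈ (· + s) ⁻¹' J := by simpa using hs
    have hJs : IsOpen ((· + s) ⁻¹' J) := hJ.preimage (by fun_prop)
    have hcd : MDifferentiableAt 𝓘(ℝ, ℝ) (𝓡 n) c 0 :=
      ((hgeo s).1.contMDiffAt (hJs.mem_nhds hcJ)).mdifferentiableAt (by simp)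
    have hvel : velocity (n := n) c 0 ∈ tangentSpaceOf N (c 0) := by
      rw [h.mem_tangentSpaceOf_iff hcs hcN]
      rw [← (hasDerivAt_chart_comp h.mem_maximalAtlas hcd hcs).deriv]
      have : deriv (fun t => f (t + s)) 0 = deriv f (0 + s) := deriv_comp_add_const f s 0
      rw [zero_add] at this
      exact this ▸ hs2
    obtain ⟨ε, hε, -, hεN⟩ := hN.2 _ c hJs
      (hJc.preimage_mono fun _ _ h => add_le_add_left h s) hcJ (hgeo s) hcN hvel
    have hnear : ∀ᶠ t in 𝓝 s, t ∈ J ∧ f t ∈ W := by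
      filter_upwards [hJ.mem_nhds hs, Ioo_mem_nhds (sub_lt_self s hε) (lt_add_of_pos_right s hε)]
        with t ht1 ht2
      refine ⟨ht1, (h.mem_iff _ (hsource t ht1)).1 ?_⟩
      have := hεN (t - s) ⟨by linarith [ht2.1], by linarith [ht2.2]⟩
      simpa [c] using this
    -- At times near `s` the curve `f` lies in `W` on a whole neighbourhood, so its derivative does
    -- too.
    filter_upwards [hnear.eventually_nhds] with t ht
    have ht' := ht.self_of_nhds
    refine ⟨ht'.1, ht'.2, ?_⟩
    exact ((hfc.contDiffAt (hJ.mem_nhds ht'.1)).differentiableAt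
      (by simp)).hasDerivAt.mem_submodule W (ht.mono fun _ h => h.2)
  have hsub : J ⊆ B := by
    refine hJc.isPreconnected.subset_of_closure_inter_subset hB ⟨0, h0, h0, hγ0, hγ0'⟩ ?_
    rintro t ⟨htB, htJ⟩
    have hmem : ∀ {k : ℝ → EuclideanSpace ℝ (Fin n)}, ContinuousOn k J → (∀ s ∈ B, k s ∈ W) →
        k t ∈ W := by
      intro k hk hkB
      have : ContinuousWithinAt k B t := (hk.continuousAt (hJ.mem_nhds htJ)).continuousWithinAt
      have h1 := this.mem_closure htB hkB
      rwa [hW.closure_eq] at h1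
    exact ⟨htJ, hmem hf0 fun s hs => hs.2.1, hmem hf1 fun s hs => hs.2.2⟩
  exact fun t ht => (h.mem_iff _ (hsource t ht)).2 (hsub ht).2.1

end MagneticGeometry
end

/-! ### The slice chart of the intersection. -/

noncomputable section

namespace MagneticGeometry

variable {n : ℕ} {M : Type*} [TopologicalSpace M] [ChartedSpace (EuclideanSpace ℝ (Fin n)) M]

theorem chartDeriv_eq_fderiv {φ : OpenPartialHomeomorph M (EuclideanSpace ℝ (Fin n))}
    (hφ : φ ∈ IsManifold.maximalAtlas (𝓡 n) ∞ M) {p : M} (hp : p ∈ φ.source) :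
    chartDeriv φ p = fderiv ℝ (fun y => φ ((extChartAt (𝓡 n) p).symm y)) (extChartAt (𝓡 n) p p) := by
  have h1 : MDifferentiableAt (𝓡 n) 𝓘(ℝ, EuclideanSpace ℝ (Fin n)) φ p :=
    (mdifferentiable_of_mem_maximalAtlas hφ).mdifferentiableAt hp
  rw [chartDeriv, h1.mfderiv, ModelWithCorners.range_eq_univ, fderivWithin_univ]
  rfl

variable [IsManifold (𝓡 n) ∞ M]

/-- Solutions of the magnetic geodesic equation in a chart which start tangentially to a totally
magnetic submanifold stay in it. -/
theorem IsSliceChart.chart_symm_mem {g : Metric n M} {σ : MagneticField n M}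
    {φ : OpenPartialHomeomorph M (EuclideanSpace ℝ (Fin n))}
    {W : Submodule ℝ (EuclideanSpace ℝ (Fin n))} {N : Set M} (h : IsSliceChart φ W N)
    (hN : IsTotallyMagnetic g σ N) {p : M} (hp : p ∈ φ.source) (hpN : p ∈ N)
    {z u : ℝ → EuclideanSpace ℝ (Fin n)} {ε : ℝ} (hε : 0 < ε) (hz0 : z 0 = extChartAt (𝓡 n) p p)
    (hu0 : chartDeriv φ p (u 0) ∈ W)
    (hz : ∀ t ∈ Ioo (-ε) ε, HasDerivAt z (u t) t ∧
      HasDerivAt u (magneticAcceleration g σ p (z t, u t)) t ∧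
      z t ∈ (extChartAt (𝓡 n) p).target ∧ (extChartAt (𝓡 n) p).symm (z t) ∈ φ.source) :
    ∀ t ∈ Ioo (-ε) ε, (extChartAt (𝓡 n) p).symm (z t) ∈ N := by
  have h0 : (0 : ℝ) ∈ Ioo (-ε) ε := ⟨neg_lt_zero.2 hε, hε⟩
  -- All time shifts are needed because the totally magnetic condition speaks of time `0` only; the
  -- equation is autonomous.
  have hgeo : ∀ s, IsMagneticGeodesicOn g σ (fun t => (extChartAt (𝓡 n) p).symm (z (t + s)))
      ((· + s) ⁻¹' Ioo (-ε) ε) := by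
    intro s
    have hJ : IsOpen ((· + s) ⁻¹' Ioo (-ε) ε) := isOpen_Ioo.preimage (by fun_prop)
    have hsol : ∀ t ∈ (· + s) ⁻¹' Ioo (-ε) ε, HasDerivAt (fun t => z (t + s)) (u (t + s)) t ∧
        HasDerivAt (fun t => u (t + s)) (magneticAcceleration g σ p (z (t + s), u (t + s))) t ∧
        (z (t + s), u (t + s)) ∈ (extChartAt (𝓡 n) p).target ×ˢ univ := fun t ht =>
      ⟨(hz _ ht).1.comp_add_const t s, (hz _ ht).2.1.comp_add_const t s, (hz _ ht).2.2.1, trivial⟩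
    refine isMagneticGeodesicOn_chart_symm g σ p (u := fun t => u (t + s))
      (a := fun t => magneticAcceleration g σ p (z (t + s), u (t + s))) hJ
      (contDiffOn_of_second_order_ODE (contDiffOn_magneticAcceleration g σ p) hJ hsol) fun t ht => ?_
    obtain ⟨h1, h2, h3⟩ := hsol t ht
    exact ⟨h1, h2, h3.1, solvesMagneticODE_magneticAcceleration g σ p
      (x := (z (t + s), u (t + s))) h3.1⟩
  have hγ := (hgeo 0).1
  simp only [add_zero, preimage_id'] at hγ
  have hγ0 : (extChartAt (𝓡 n) p).symm (z 0) = p := by rw [hz0, extChartAt_to_inv]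
  refine h.mem_of_isMagneticGeodesicOn hN isOpen_Ioo ordConnected_Ioo h0 hγ hgeo
    (fun t ht => (hz t ht).2.2.2) ?_ ?_
  · rw [hγ0]
    exact (h.mem_iff p hp).1 hpN
  · have h1 := hasDerivAt_chart_comp h.mem_maximalAtlas
      ((hγ.contMDiffAt (isOpen_Ioo.mem_nhds h0)).mdifferentiableAt (by simp)) (hz 0 h0).2.2.2
    rw [h1.deriv]
    have h2 := velocity_chart_symm p (hz 0 h0).2.2.1 (hz 0 h0).1
    rw [hz0, chartSymmDeriv_self] at h2
    have h3 : chartDeriv φ ((extChartAt (𝓡 n) p).symm (z 0))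
        (velocity (fun s => (extChartAt (𝓡 n) p).symm (z s)) 0) = chartDeriv φ p (u 0) :=
      congrArg₂ (fun q (v : EuclideanSpace ℝ (Fin n)) => chartDeriv φ q v) hγ0 h2
    rw [h3]
    exact hu0

/-- The intersection of two totally magnetic submanifolds has a slice chart at each of its points,
in the direction of the intersection of the tangent spaces. -/
theorem exists_isSliceChart_inter {g : Metric n M} {σ : MagneticField n M} {N₁ N₂ : Set M}
    (h₁ : IsTotallyMagnetic g σ N₁) (h₂ : IsTotallyMagnetic g σ N₂) {p : M} (hp : p ∈ N₁ ∩ N₂) :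
    ∃ (χ : OpenPartialHomeomorph M (EuclideanSpace ℝ (Fin n)))
      (T : Submodule ℝ (EuclideanSpace ℝ (Fin n))), IsSliceChart χ T (N₁ ∩ N₂) ∧ p ∈ χ.source ∧
      (∀ v : TangentSpace (𝓡 n) p, chartDeriv χ p v ∈ T ↔
        v ∈ tangentSpaceOf N₁ p ∩ tangentSpaceOf N₂ p) ∧ Convex ℝ χ.target := by
  obtain ⟨k₁, hk₁⟩ := h₁.1
  obtain ⟨k₂, hk₂⟩ := h₂.1
  obtain ⟨φ₁, hφ₁, hp₁, W₁, -, hW₁⟩ := hk₁ p hp.1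
  obtain ⟨φ₂, hφ₂, hp₂, W₂, -, hW₂⟩ := hk₂ p hp.2
  have hs₁ : IsSliceChart φ₁ W₁ N₁ := ⟨hφ₁, hW₁⟩
  have hs₂ : IsSliceChart φ₂ W₂ N₂ := ⟨hφ₂, hW₂⟩
  set κ := extChartAt (𝓡 n) p with hκ
  set y₀ := κ p with hy₀
  have hy₀t : y₀ ∈ κ.target := mem_extChartAt_target p
  have hy₀p : κ.symm y₀ = p := extChartAt_to_inv p
  let U : Set (EuclideanSpace ℝ (Fin n)) := κ.target ∩ κ.symm ⁻¹' (φ₁.source ∩ φ₂.source)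
  have hU : IsOpen U := (continuousOn_extChartAt_symm p).isOpen_inter_preimage (isOpen_target p)
    (φ₁.open_source.inter φ₂.open_source)
  have hyU : y₀ ∈ U := ⟨hy₀t, by simp only [mem_preimage, hy₀p]; exact ⟨hp₁, hp₂⟩⟩
  let c₁ : EuclideanSpace ℝ (Fin n) → EuclideanSpace ℝ (Fin n) := fun y => φ₁ (κ.symm y)
  let c₂ : EuclideanSpace ℝ (Fin n) → EuclideanSpace ℝ (Fin n) := fun y => φ₂ (κ.symm y)
  have hc₁ : ContDiffOn ℝ ∞ c₁ U := by
    rw [← contMDiffOn_iff_contDiffOn]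
    exact (contMDiffOn_of_mem_maximalAtlas hφ₁).comp
      ((contMDiffOn_chart_symm p).mono inter_subset_left) fun y hy => hy.2.1
  have hc₂ : ContDiffOn ℝ ∞ c₂ U := by
    rw [← contMDiffOn_iff_contDiffOn]
    exact (contMDiffOn_of_mem_maximalAtlas hφ₂).comp
      ((contMDiffOn_chart_symm p).mono inter_subset_left) fun y hy => hy.2.2
  have hA₁ : HasFDerivAt c₁ (chartDeriv φ₁ p) y₀ := by
    rw [chartDeriv_eq_fderiv hφ₁ hp₁]
    exact ((hc₁.contDiffAt (hU.mem_nhds hyU)).differentiableAt (by simp)).hasFDerivAt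
  have hA₂ : HasFDerivAt c₂ (chartDeriv φ₂ p) y₀ := by
    rw [chartDeriv_eq_fderiv hφ₂ hp₂]
    exact ((hc₂.contDiffAt (hU.mem_nhds hyU)).differentiableAt (by simp)).hasFDerivAt
  obtain ⟨P, D₁, D₂, hP, hD₁, hD₂, hsum⟩ :=
    exists_decomposition_of_comap_inf_comap (chartDeriv φ₁ p) (chartDeriv φ₂ p) W₁ W₂
  let T : Submodule ℝ (EuclideanSpace ℝ (Fin n)) :=
    W₁.comap (chartDeriv φ₁ p).toLinearMap ⊓ W₂.comap (chartDeriv φ₂ p).toLinearMap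
  -- The decomposition of the identity with the linear maps `chartDeriv φᵢ p` replaced by the slice
  -- coordinates `cᵢ`. The derivative at `y₀` is still the identity, and on `N₁ ∩ N₂` the `Dᵢ` terms
  -- vanish, leaving a value of `P`, which lies in `T`.
  let f : EuclideanSpace ℝ (Fin n) → EuclideanSpace ℝ (Fin n) := fun y =>
    P (y - y₀) + D₁ (c₁ y - c₁ y₀) + D₂ (c₂ y - c₂ y₀)
  have hf0 : f y₀ = 0 := by simp [f]
  have hfc : ContDiffOn ℝ ∞ f U :=
    ((P.contDiff.comp_contDiffOn (contDiffOn_id.sub contDiffOn_const)).add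
      (D₁.contDiff.comp_contDiffOn (hc₁.sub contDiffOn_const))).add
      (D₂.contDiff.comp_contDiffOn (hc₂.sub contDiffOn_const))
  have hf' : HasFDerivAt f (ContinuousLinearMap.id ℝ _) y₀ := by
    have h3 := ((P.hasFDerivAt.comp y₀ ((hasFDerivAt_id y₀).sub_const y₀)).add
      (D₁.hasFDerivAt.comp y₀ (hA₁.sub_const (c₁ y₀)))).add
      (D₂.hasFDerivAt.comp y₀ (hA₂.sub_const (c₂ y₀)))
    refine h3.congr_fderiv ?_
    ext1 x
    exact hsum x
  have hfT : ∀ y ∈ U, κ.symm y ∈ N₁ ∩ N₂ → f y ∈ T := by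
    intro y hy hyN
    have e₁ : D₁ (c₁ y - c₁ y₀) = 0 := hD₁ _ (W₁.sub_mem ((hW₁ _ hy.2.1).1 hyN.1)
      ((hW₁ _ hyU.2.1).1 (hy₀p.symm ▸ hp.1)))
    have e₂ : D₂ (c₂ y - c₂ y₀) = 0 := hD₂ _ (W₂.sub_mem ((hW₂ _ hy.2.2).1 hyN.2)
      ((hW₂ _ hyU.2.2).1 (hy₀p.symm ▸ hp.2)))
    simp only [f, e₁, e₂, add_zero]
    exact hP (y - y₀)
  obtain ⟨Φ, hΦf, hyΦ, hΦU, hΦsymm⟩ := exists_smooth_openPartialHomeomorph hU hyU hfc hf'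
  have hstrict : HasStrictFDerivAt f (ContinuousLinearMap.id ℝ _) y₀ :=
    (hfc.contDiffAt (hU.mem_nhds hyU)).hasStrictFDerivAt' hf' (by simp)
  have hacc : ContDiffAt ℝ 1 (magneticAcceleration g σ p) (y₀, 0) :=
    ((contDiffOn_magneticAcceleration g σ p).contDiffAt
      (((isOpen_target p).prod isOpen_univ).mem_nhds ⟨hy₀t, trivial⟩)).of_le (by simp)
  -- A substitute for the exponential map. Magnetic geodesics do not rescale with speed, so a fixed
  -- short time and small velocities are used. The curves are kept in `Φ.source`, where `f` is
  -- injective.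
  obtain ⟨τ, hτ, r, hr, z, u, hflow, hest, hz0⟩ := exists_second_order_flow hacc
    (magneticAcceleration_zero g σ p y₀) (V := Φ.source ×ˢ univ)
    ((Φ.open_source.prod isOpen_univ).mem_nhds ⟨hyΦ, trivial⟩) (δ := 1 / 4) (by norm_num)
  have hτmem : τ ∈ Ioo (-(2 * τ)) (2 * τ) := ⟨by linarith, by linarith⟩
  have hstay : ∀ v ∈ T, v ∈ Metric.ball (0 : EuclideanSpace ℝ (Fin n)) r →
      κ.symm (z v τ) ∈ N₁ ∩ N₂ := by
    intro v hvT hv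
    obtain ⟨hz, hu, hsol⟩ := hflow v hv
    refine ⟨hs₁.chart_symm_mem h₁ hp₁ hp.1 (ε := 2 * τ) (by positivity) hz (hu.symm ▸ hvT.1)
        (fun t ht => ?_) τ hτmem,
      hs₂.chart_symm_mem h₂ hp₂ hp.2 (ε := 2 * τ) (by positivity) hz (hu.symm ▸ hvT.2)
        (fun t ht => ?_) τ hτmem⟩
    · obtain ⟨e1, e2, e3⟩ := hsol t ht
      exact ⟨e1, e2, (hΦU e3.1).1, (hΦU e3.1).2.1⟩
    · obtain ⟨e1, e2, e3⟩ := hsol t ht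
      exact ⟨e1, e2, (hΦU e3.1).1, (hΦU e3.1).2.2⟩
  have hcover := eventually_exists_eq_of_approximates (f := f) (Z := fun v => z v τ) hτ hr T hstrict
    hf0 hz0 hest fun v hvT hv =>
      hfT _ (hΦU ((hflow v hv).2.2 τ hτmem).2.2.1) (hstay v hvT hv)
  let Ψ : OpenPartialHomeomorph M (EuclideanSpace ℝ (Fin n)) :=
    (chartAt (EuclideanSpace ℝ (Fin n)) p).trans Φ
  have hΨ : ∀ q, Ψ q = f (κ q) := fun q => by rw [← hΦf]; rfl
  have hΨsource : ∀ q, q ∈ Ψ.source ↔ q ∈ κ.source ∧ κ q ∈ Φ.source := by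
    intro q
    rw [hκ, extChartAt_source, OpenPartialHomeomorph.trans_source]
    rfl
  have hpΨ : p ∈ Ψ.source := (hΨsource p).2 ⟨mem_extChartAt_source p, hyΦ⟩
  have hΨp : Ψ p = 0 := by rw [hΨ, ← hy₀, hf0]
  obtain ⟨ρ, hρ, hρs⟩ := Metric.mem_nhds_iff.1
    (inter_mem (Ψ.open_target.mem_nhds (hΨp ▸ Ψ.map_source hpΨ)) hcover)
  -- The target is cut down to a ball: it is then convex, and all its points in `T` are covered by
  -- `f ∘ Z`.
  let χ := (Ψ.symm.restrOpen (Metric.ball 0 ρ) Metric.isOpen_ball).symm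
  have hχ : ∀ q, χ q = f (κ q) := hΨ
  have hχsource : ∀ q, q ∈ χ.source ↔ q ∈ Ψ.source ∧ f (κ q) ∈ Metric.ball 0 ρ := by
    intro q
    have : q ∈ χ.source ↔ q ∈ Ψ.source ∧ Ψ q ∈ Metric.ball 0 ρ := by
      simp [χ]
    rw [this, hΨ]
  have hχtarget : χ.target = Metric.ball 0 ρ := by
    have : χ.target = Ψ.target ∩ Metric.ball 0 ρ := rfl
    rw [this]
    exact inter_eq_right.2 fun x hx => (hρs hx).1
  have hpχ : p ∈ χ.source := (hχsource p).2 ⟨hpΨ, by rw [← hy₀, hf0]; exact Metric.mem_ball_self hρ⟩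
  have hχmax : χ ∈ IsManifold.maximalAtlas (𝓡 n) ∞ M := by
    refine OpenPartialHomeomorph.mem_maximalAtlas_of_contMDiffOn χ ?_ ?_
    · have h3 : ContMDiffOn (𝓡 n) (𝓡 n) ∞ (f ∘ κ) χ.source := by
        refine (contMDiffOn_iff_contDiffOn.2 hfc).comp
          ((contMDiffOn_extChartAt (I := 𝓡 n) (x := p)).mono fun q hq => ?_) fun q hq =>
            hΦU ((hΨsource q).1 ((hχsource q).1 hq).1).2
        have := ((hΨsource q).1 ((hχsource q).1 hq).1).1
        rwa [hκ, extChartAt_source] at this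
      exact h3.congr fun q _ => hχ q
    · have h3 : ContMDiffOn (𝓡 n) (𝓡 n) ∞ (κ.symm ∘ Φ.symm) Φ.target :=
        (contMDiffOn_chart_symm p).comp (contMDiffOn_iff_contDiffOn.2 hΦsymm) fun x hx =>
          (hΦU (Φ.map_target hx)).1
      refine h3.mono fun x hx => ?_
      have h4 : x ∈ Ψ.target := hx.1
      exact h4.1
  have hslice : IsSliceChart χ T (N₁ ∩ N₂) := by
    refine ⟨hχmax, fun q hq => ?_⟩
    obtain ⟨hqΨ, hqρ⟩ := (hχsource q).1 hq
    obtain ⟨hqκ, hqΦ⟩ := (hΨsource q).1 hqΨ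
    have hqq : κ.symm (κ q) = q := κ.left_inv hqκ
    rw [hχ]
    constructor
    · intro hqN
      exact hfT _ (hΦU hqΦ) (hqq.symm ▸ hqN)
    -- The value `f (κ q)` equals `f (z v τ)` for some `v ∈ T`; injectivity identifies `q` with a
    -- point reached by a geodesic inside both submanifolds.
    · intro hqT
      obtain ⟨v, hvT, hv, hvq⟩ := (hρs hqρ).2 hqT
      have h3 : z v τ = κ q := by
        refine Φ.injOn ((hflow v hv).2.2 τ hτmem).2.2.1 hqΦ ?_
        rw [hΦf]
        exact hvq
      have h4 := hstay v hvT hv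
      rwa [h3, hqq] at h4
  refine ⟨χ, T, hslice, hpχ, fun v => ?_, hχtarget ▸ convex_ball 0 ρ⟩
  have hχ' : chartDeriv χ p = ContinuousLinearMap.id ℝ _ := by
    rw [chartDeriv_eq_fderiv hχmax hpχ, ← hf'.fderiv]
    refine Filter.EventuallyEq.fderiv_eq ?_
    filter_upwards [(isOpen_target p).mem_nhds hy₀t] with y hy
    rw [hχ]
    exact congrArg f (κ.right_inv hy)
  have e₁ := hs₁.mem_tangentSpaceOf_iff hp₁ hp.1 v
  have e₂ := hs₂.mem_tangentSpaceOf_iff hp₂ hp.2 v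
  rw [hχ', mem_inter_iff, e₁, e₂]
  rfl

end MagneticGeometry
end

/-! ### Connected components: inherited slice charts and constant dimension. -/

noncomputable section

namespace MagneticGeometry

variable {n : ℕ} {M : Type*} [TopologicalSpace M] [ChartedSpace (EuclideanSpace ℝ (Fin n)) M]

/-- The intersection with the domain of a slice chart with convex target lies in one connected
component. -/
theorem IsSliceChart.inter_source_subset_connectedComponentIn
    {χ : OpenPartialHomeomorph M (EuclideanSpace ℝ (Fin n))}
    {T : Submodule ℝ (EuclideanSpace ℝ (Fin n))} {N : Set M} (h : IsSliceChart χ T N)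
    (hconv : Convex ℝ χ.target) {p : M} (hp : p ∈ χ.source) (hpN : p ∈ N) :
    χ.source ∩ N ⊆ connectedComponentIn N p := by
  have himg : χ.source ∩ N = χ.symm '' (χ.target ∩ T) := by
    ext q
    constructor
    · rintro ⟨hq, hqN⟩
      exact ⟨χ q, ⟨χ.map_source hq, (h.mem_iff q hq).1 hqN⟩, χ.left_inv hq⟩
    · rintro ⟨x, ⟨hx, hxT⟩, rfl⟩
      refine ⟨χ.map_target hx, (h.mem_iff _ (χ.map_target hx)).2 ?_⟩
      rwa [χ.right_inv hx]
  have hpre : IsPreconnected (χ.source ∩ N) := by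
    rw [himg]
    exact (hconv.inter T.convex).isPreconnected.image _
      (χ.continuousOn_symm.mono inter_subset_left)
  exact hpre.subset_connectedComponentIn ⟨hp, hpN⟩ inter_subset_right

/-- Inside a slice chart with convex target, `N` corresponds to a convex set and so lies in one
component: there `N` and its component coincide. -/
theorem IsSliceChart.connectedComponentIn
    {χ : OpenPartialHomeomorph M (EuclideanSpace ℝ (Fin n))}
    {T : Submodule ℝ (EuclideanSpace ℝ (Fin n))} {N : Set M} (h : IsSliceChart χ T N)
    (hconv : Convex ℝ χ.target) {p : M} (hp : p ∈ χ.source) (hpN : p ∈ N) :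
    IsSliceChart χ T (connectedComponentIn N p) :=
  ⟨h.mem_maximalAtlas, fun q hq => ⟨fun hqC => (h.mem_iff q hq).1
    (connectedComponentIn_subset N p hqC), fun hqT =>
    h.inter_source_subset_connectedComponentIn hconv hp hpN ⟨hq, (h.mem_iff q hq).2 hqT⟩⟩⟩

/-- The dimension of a submanifold at a point. -/
def dimAt (N : Set M) (p : M) : ℕ :=
  Module.finrank ℝ (Submodule.span ℝ
    (show Set (EuclideanSpace ℝ (Fin n)) from tangentSpaceOf (n := n) N p))

theorem IsSliceChart.dimAt_eq {χ : OpenPartialHomeomorph M (EuclideanSpace ℝ (Fin n))}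
    {T : Submodule ℝ (EuclideanSpace ℝ (Fin n))} {N : Set M} (h : IsSliceChart χ T N) {p : M}
    (hp : p ∈ χ.source) (hpN : p ∈ N) : dimAt (n := n) N p = Module.finrank ℝ T := by
  let e := LinearEquiv.ofInjectiveEndo (chartDeriv χ p).toLinearMap
    (chartDeriv_injective h.mem_maximalAtlas hp)
  have hset : (show Set (EuclideanSpace ℝ (Fin n)) from tangentSpaceOf (n := n) N p) =
      (T.comap (e : EuclideanSpace ℝ (Fin n) →ₗ[ℝ] EuclideanSpace ℝ (Fin n)) :
        Set (EuclideanSpace ℝ (Fin n))) := by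
    ext v
    exact h.mem_tangentSpaceOf_iff hp hpN v
  rw [dimAt, hset, Submodule.span_eq, Submodule.comap_equiv_eq_map_symm]
  exact LinearEquiv.finrank_map_eq e.symm T

/-- Every connected component of a set with slice charts at all its points is an embedded
submanifold. -/
theorem isEmbeddedSubmanifold_connectedComponentIn {N : Set M}
    (h : ∀ p ∈ N, ∃ (χ : OpenPartialHomeomorph M (EuclideanSpace ℝ (Fin n)))
      (T : Submodule ℝ (EuclideanSpace ℝ (Fin n))), IsSliceChart χ T N ∧ p ∈ χ.source ∧
        Convex ℝ χ.target) (p : M) :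
    IsEmbeddedSubmanifold (n := n) (dimAt (n := n) N p) (connectedComponentIn N p) := by
  intro q hq
  have hqN : q ∈ N := connectedComponentIn_subset N p hq
  have hpN : p ∈ N := connectedComponentIn_nonempty_iff.1 ⟨q, hq⟩
  obtain ⟨χ, T, hχ, hqχ, hconv⟩ := h q hqN
  -- The subspaces at different points of `N` could differ in dimension. The dimension is locally
  -- constant on `N`, hence constant on each component.
  have hcont : ContinuousOn (dimAt (n := n) N) N := by
    intro x hx
    obtain ⟨χ', T', hχ', hxχ', -⟩ := h x hx
    refine tendsto_const_nhds.congr' ?_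
    filter_upwards [self_mem_nhdsWithin, mem_nhdsWithin_of_mem_nhds (χ'.open_source.mem_nhds hxχ')]
      with y hyN hy
    rw [hχ'.dimAt_eq hy hyN, hχ'.dimAt_eq hxχ' hx]
  have hdim : dimAt (n := n) N q = dimAt (n := n) N p :=
    isPreconnected_connectedComponentIn.constant (hcont.mono (connectedComponentIn_subset N p)) hq
      (mem_connectedComponentIn hpN)
  have hC := hχ.connectedComponentIn hconv hqχ hqN
  rw [← connectedComponentIn_eq hq] at hC
  exact ⟨χ, hχ.mem_maximalAtlas, hqχ, T, by rw [← hχ.dimAt_eq hqχ hqN, hdim], hC.mem_iff⟩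

variable [IsManifold (𝓡 n) ∞ M]

/-- The slice chart of the intersection at `q` is also one for the component, and its subspace was
built from the two tangent spaces. -/
theorem tangentSpaceOf_connectedComponentIn_inter {g : Metric n M} {σ : MagneticField n M}
    {N₁ N₂ : Set M} (h₁ : IsTotallyMagnetic g σ N₁) (h₂ : IsTotallyMagnetic g σ N₂) {p q : M}
    (hq : q ∈ connectedComponentIn (N₁ ∩ N₂) p) :
    tangentSpaceOf (n := n) (connectedComponentIn (N₁ ∩ N₂) p) q =
      tangentSpaceOf N₁ q ∩ tangentSpaceOf N₂ q := by
  have hqN := connectedComponentIn_subset _ p hq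
  obtain ⟨χ, T, hχ, hqχ, hT, hconv⟩ := exists_isSliceChart_inter h₁ h₂ hqN
  have hC := hχ.connectedComponentIn hconv hqχ hqN
  rw [← connectedComponentIn_eq hq] at hC
  ext v
  rw [hC.mem_tangentSpaceOf_iff hqχ hq, hT]

end MagneticGeometry
end

theorem mainTheorem5 {n : ℕ} {M : Type*} [TopologicalSpace M]
    [ChartedSpace (EuclideanSpace ℝ (Fin n)) M] [IsManifold (𝓡 n) ∞ M]
    [T2Space M] [CompactSpace M] [ConnectedSpace M]
    (g : MagneticGeometry.Metric n M) (σ : MagneticGeometry.MagneticField n M)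
    (N₁ N₂ : Set M)
    (h₁ : MagneticGeometry.IsTotallyMagnetic g σ N₁)
    (h₂ : MagneticGeometry.IsTotallyMagnetic g σ N₂) :
    ∀ p ∈ N₁ ∩ N₂,
      MagneticGeometry.IsTotallyMagnetic g σ (connectedComponentIn (N₁ ∩ N₂) p) ∧
      ∀ q ∈ connectedComponentIn (N₁ ∩ N₂) p,
        MagneticGeometry.tangentSpaceOf (n := n) (connectedComponentIn (N₁ ∩ N₂) p) q =
          MagneticGeometry.tangentSpaceOf N₁ q ∩ MagneticGeometry.tangentSpaceOf N₂ q := by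
  intro p _
  refine ⟨⟨⟨_, MagneticGeometry.isEmbeddedSubmanifold_connectedComponentIn (n := n) (fun q hq => ?_)
    p⟩, ?_⟩, fun q hq => MagneticGeometry.tangentSpaceOf_connectedComponentIn_inter h₁ h₂ hq⟩
  · obtain ⟨χ, T, hχ, hqχ, -, hconv⟩ := MagneticGeometry.exists_isSliceChart_inter h₁ h₂ hq
    exact ⟨χ, T, hχ, hqχ, hconv⟩
  · intro J γ hJ hJc h0 hγ hγ0 hvel
    rw [MagneticGeometry.tangentSpaceOf_connectedComponentIn_inter h₁ h₂ hγ0] at hvel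
    have hγN := connectedComponentIn_subset _ p hγ0
    obtain ⟨ε₁, hε₁, hJ₁, hN₁⟩ := h₁.2 J γ hJ hJc h0 hγ hγN.1 hvel.1
    obtain ⟨ε₂, hε₂, -, hN₂⟩ := h₂.2 J γ hJ hJc h0 hγ hγN.2 hvel.2
    have hsub₁ : Ioo (-min ε₁ ε₂) (min ε₁ ε₂) ⊆ Ioo (-ε₁) ε₁ :=
      Ioo_subset_Ioo (neg_le_neg (min_le_left _ _)) (min_le_left _ _)
    have hsub₂ : Ioo (-min ε₁ ε₂) (min ε₁ ε₂) ⊆ Ioo (-ε₂) ε₂ :=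
      Ioo_subset_Ioo (neg_le_neg (min_le_right _ _)) (min_le_right _ _)
    refine ⟨min ε₁ ε₂, lt_min hε₁ hε₂, hsub₁.trans hJ₁, fun t ht => ?_⟩
    -- For short times the geodesic lies in both submanifolds; its image is connected and contains
    -- `γ 0`, so it cannot leave the component.
    have hpre : IsPreconnected (γ '' Ioo (-min ε₁ ε₂) (min ε₁ ε₂)) :=
      isPreconnected_Ioo.image _ (hγ.1.continuousOn.mono (hsub₁.trans hJ₁))
    have hmem : γ 0 ∈ γ '' Ioo (-min ε₁ ε₂) (min ε₁ ε₂) :=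
      ⟨0, ⟨neg_lt_zero.2 (lt_min hε₁ hε₂), lt_min hε₁ hε₂⟩, rfl⟩
    rw [connectedComponentIn_eq hγ0]
    refine hpre.subset_connectedComponentIn hmem ?_ ⟨t, ht, rfl⟩
    rintro _ ⟨s, hs, rfl⟩
    exact ⟨hN₁ s (hsub₁ hs), hN₂ s (hsub₂ hs)⟩
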